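/- **Proposition.** For a locally integrable function $\mathsf b:\mathbb R\to\mathbb C$ let $\|\mathsf b\|_{BMO}=\sup_I \frac1{|I|}\int_I|\mathsf b-\frac1{|I|}\int_I\mathsf b|$, the supremum being over bounded nondegenerate intervals $I$, and write $\mathsf b\in BMO(\mathbb R)$ if this is finite. Put $\mathrm{avg}_x^y\,\mathsf b=\frac{\int_y^x\mathsf b(\alpha)\,d\alpha}{x-y}$ for $x\ne y$, and let $M(f)(x)=\sup_{I\ni x}\frac1{|I|}\int_I|f|$ be the (uncentered) Hardy-Littlewood maximal function. There is a universal constant $C$ (in particular independent of $n$) such that the following holds. Let $\mathsf b\in BMO(\mathbb R)$, let $f_1,f_2,\dots$ be complex-valued functions in $C^1(\mathbb R)$ with $f_i'\in L^2(\mathbb R)$, and let $g\in L^2(\mathbb R)$. Then all the integrals below converge absolutely for almost every $x$, define measurable functions of $x$, and satisfy \begin{align*} \Big\|\int\big(\mathsf b(y)-\mathrm{avg}_x^y\,\mathsf b\big)\frac{\prod_{i=1}^2(f_i(x)-f_i(y))}{(x-y)^2}\,dy\Big\|_{L^\infty}&\le C\|\mathsf b\|_{BMO}\|f_1'\|_{L^2}\|f_2'\|_{L^2},\\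 \Big\|\int\big(\mathsf b(y)-\mathrm{avg}_x^y\,\mathsf b\big)^2\frac{\prod_{i=1}^2(f_i(x)-f_i(y))}{(x-y)^2}\,dy\Big\|_{L^\infty}&\le C\|\mathsf b\|_{BMO}^2\|f_1'\|_{L^2}\|f_2'\|_{L^2},\\ \Big\|\int\big(\mathsf b(x)+\mathsf b(y)-2\,\mathrm{avg}_x^y\,\mathsf b\big)\frac{\prod_{i=1}^2(f_i(x)-f_i(y))}{(x-y)^2}g(y)\,dy\Big\|_{L^2}&\le C\|\mathsf b\|_{BMO}\|f_1'\|_{L^2}\|f_2'\|_{L^2}\|g\|_{L^2},\\ \Big\|\int\frac{(\mathsf b(x)-\mathsf b(y))\prod_{i=1}^2(f_i(x)-f_i(y))}{(x-y)^2}g(y)\,dy\Big\|_{L^2}&\le C\|\mathsf b\|_{BMO}\|f_1'\|_{L^2}\|f_2'\|_{L^2}\|g\|_{L^2},\\ \Big\|\int\big(\mathsf b(x)+\mathsf b(y)-2\,\mathrm{avg}_x^y\,\mathsf b\big)\frac{\prod_{i=1}^3(f_i(x)-f_i(y))}{(x-y)^3}\,dy\Big\|_{L^2}&\le C\|\mathsf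 b\|_{BMO}\|f_1'\|_{L^2}\|f_2'\|_{L^2}\|f_3'\|_{L^2},\\ \Big\|\int\frac{(\mathsf b(x)-\mathsf b(y))\prod_{i=1}^3(f_i(x)-f_i(y))}{(x-y)^3}\,dy\Big\|_{L^2}&\le C\|\mathsf b\|_{BMO}\|f_1'\|_{L^2}\|f_2'\|_{L^2}\|f_3'\|_{L^2}, \end{align*} and, for every $n\ge3$, $$\Big\|\int\frac{(\mathsf b(x)-\mathsf b(y))\prod_{i=1}^n(f_i(x)-f_i(y))}{(x-y)^n}g(y)\,dy\Big\|_{L^2}\le C\|\mathsf b\|_{BMO}\|f_1'\|_{L^2}\|f_2'\|_{L^2}\Big\|g\prod_{i=3}^nM(f_i')\Big\|_{L^2}.$$ (The right-hand side of the last inequality may be infinite, with the convention $0\cdot\infty=0$.) -/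

import Mathlib

open MeasureTheory

noncomputable section

/-- The `BMO` seminorm of `b : ℝ → ℂ`: the supremum over all bounded nondegenerate intervals of the
mean oscillation of `b` on the interval (an extended nonnegative real). -/
def bmoNorm (b : ℝ → ℂ) : ENNReal :=
  ⨆ (a : ℝ) (c : ℝ) (_ : a < c),
    ⨍⁻ t in Set.Icc a c, ‖b t - ⨍ s in Set.Icc a c, b s ∂volume‖ₑ ∂volume

/-- Functions of bounded mean oscillation on the line. -/
def MemBMO (b : ℝ → ℂ) : Prop :=
  LocallyIntegrable b volume ∧ bmoNorm b < ⊤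

/-- The Hardy-Littlewood maximal function of `f`: the supremum of the means of `|f|` over all
bounded nondegenerate intervals containing the point. -/
def maximalFn (f : ℝ → ℂ) (x : ℝ) : ENNReal :=
  ⨆ (a : ℝ) (c : ℝ) (_ : a < c) (_ : x ∈ Set.Icc a c), ⨍⁻ t in Set.Icc a c, ‖f t‖ₑ ∂volume

/-- The mean of `b` over the interval between `x` and `y`, that is `(∫_y^x b) / (x - y)`. -/
def avg (b : ℝ → ℂ) (x y : ℝ) : ℂ :=
  (∫ t in y..x, b t) / ((x - y : ℝ) : ℂ)

/-- Continuously differentiable functions on the line whose derivative is square integrable. -/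
def C1DerivL2 (f : ℝ → ℂ) : Prop :=
  ContDiff ℝ 1 f ∧ MemLp (deriv f) 2 volume

/-- The function `x ↦ ∫ k x y dy` is well defined (for almost every `x` the integral converges
absolutely) and measurable, and its `L^p` norm is at most `B`. -/
def IntegralBound (k : ℝ → ℝ → ℂ) (p B : ENNReal) : Prop :=
  (∀ᵐ x : ℝ, Integrable (fun y => k x y) volume) ∧
  AEStronglyMeasurable (fun x => ∫ y, k x y) volume ∧
  eLpNorm (fun x => ∫ y, k x y) p volume ≤ B

/-- The `L²` norm on the line, as an extended nonnegative real. -/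
def normL2 (f : ℝ → ℂ) : ENNReal := eLpNorm f 2 volume

end

open Set Filter Topology ENNReal

/-! Every kernel is controlled by the deviations `avgDev b x y` and `avgDev b y x` times a product
W(x, y) of the two difference quotients of f₁ and f₂. Any further quotient is at most the maximal
function of its derivative.

The central fact is that, for fixed x, both ∫ W dy and ∫ |b(y) - avg|² W dy are bounded uniformly in
x. A difference quotient is dominated by the Hardy operator centred at x applied to |f'|, and a
Hardy inequality in L² holds with any weight w whose mass on each annulus r ≤ |y - x| < 4r is O(r)
(`lintegral_weighted_hardy`). The weight w = 1 qualifies trivially. The weight w = |b(y) - avg|²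
qualifies by the L² form of John-Nirenberg (`lintegral_osc_sq_le`), proved by a stopping-time
argument on dyadic averages. Cauchy-Schwarz in y then separates f₁ from f₂ and gives the L^∞ bounds.

The L² bounds follow from a Schur-type argument (`lintegral_sq_kernel_le`): Cauchy-Schwarz splits
the kernel so that, after Tonelli, each inner integral is one of those two, by the symmetry of W.
The estimates with three functions use also the L² maximal theorem (`lintegral_maximalFn_sq_le`). -/

/-! ### Dyadic averages and the L² John-Nirenberg inequality. -/

/-- The mean of `b` over `[a, c]`, through the interval integral. -/
noncomputable def meanOn (b : ℝ → ℂ) (a c : ℝ) : ℂ := (c - a)⁻¹ • ∫ t in a..c, b t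

lemma MeasureTheory.LocallyIntegrable.intervalIntegrable_of_endpoints {b : ℝ → ℂ} (hb : LocallyIntegrable b volume) (a c : ℝ) :
    IntervalIntegrable b volume a c :=
  (hb.integrableOn_isCompact isCompact_uIcc).intervalIntegrable

lemma meanOn_eq_average (b : ℝ → ℂ) {a c : ℝ} (h : a < c) :
    meanOn b a c = ⨍ s in Icc a c, b s ∂volume := by
  rw [meanOn, setAverage_eq, integral_Icc_eq_integral_Ioc, intervalIntegral.integral_of_le h.le,
    Measure.real, Real.volume_Icc, ENNReal.toReal_ofReal (by linarith)]

lemma intervalIntegrable_norm_sub_const {b : ℝ → ℂ} (hb : LocallyIntegrable b volume) (m : ℂ) (a c : ℝ) :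
    IntervalIntegrable (fun t => ‖b t - m‖) volume a c :=
  ((hb.intervalIntegrable_of_endpoints a c).sub intervalIntegrable_const).norm

/-- Mean oscillation bound in integral form. -/
lemma lintegral_osc_le {b : ℝ → ℂ} {a c : ℝ} (h : a < c) :
    ∫⁻ t in Icc a c, ‖b t - meanOn b a c‖ₑ ≤ bmoNorm b * ENNReal.ofReal (c - a) := by
  have h1 : ⨍⁻ t in Icc a c, ‖b t - ⨍ s in Icc a c, b s ∂volume‖ₑ ∂volume ≤ bmoNorm b :=
    le_iSup_of_le a (le_iSup_of_le c (le_iSup_of_le h le_rfl))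
  rw [setLAverage_eq, Real.volume_Icc, ← meanOn_eq_average b h] at h1
  exact (ENNReal.div_le_iff (by simpa using h) ofReal_ne_top).1 h1

lemma integral_osc_le {b : ℝ → ℂ} (hb : MemBMO b) {a c : ℝ} (h : a < c) :
    ∫ t in a..c, ‖b t - meanOn b a c‖ ≤ (bmoNorm b).toReal * (c - a) := by
  have h1 := lintegral_osc_le (b := b) h
  rw [intervalIntegral.integral_of_le h.le, ← integral_Icc_eq_integral_Ioc,
    integral_norm_eq_lintegral_enorm]
  · have := ENNReal.toReal_mono (ENNReal.mul_ne_top hb.2.ne ofReal_ne_top) h1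
    rwa [ENNReal.toReal_mul, ENNReal.toReal_ofReal (by linarith)] at this
  · exact (hb.1.aestronglyMeasurable.sub aestronglyMeasurable_const).restrict

lemma norm_meanOn_sub_le {b : ℝ → ℂ} (hb : LocallyIntegrable b volume) {a c : ℝ} (h : a < c)
    (m : ℂ) : (c - a) * ‖meanOn b a c - m‖ ≤ ∫ t in a..c, ‖b t - m‖ := by
  have h0 : 0 < c - a := by linarith
  have e : (c - a) • (meanOn b a c - m) = ∫ t in a..c, (b t - m) := by
    rw [intervalIntegral.integral_sub (hb.intervalIntegrable_of_endpoints a c) intervalIntegrable_const,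
      intervalIntegral.integral_const, smul_sub, meanOn, smul_inv_smul₀ h0.ne']
  have := intervalIntegral.norm_integral_le_integral_norm (f := fun t => b t - m)
    (μ := volume) h.le
  rwa [← e, norm_smul, Real.norm_of_nonneg h0.le] at this

/-- Square deviation from `m` of the dyadic averages of `b` of generation `N` on `[a, c]`. -/
noncomputable def dyadicSq (b : ℝ → ℂ) : ℕ → ℝ → ℝ → ℂ → ℝ
  | 0, a, c, m => (c - a) * ‖meanOn b a c - m‖ ^ 2
  | N + 1, a, c, m => dyadicSq b N a ((a + c) / 2) m + dyadicSq b N ((a + c) / 2) c m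

lemma dyadicSq_le_recenter (b : ℝ → ℂ) (N : ℕ) : ∀ {a c : ℝ}, a < c → ∀ m m' : ℂ,
    dyadicSq b N a c m ≤ 2 * dyadicSq b N a c m' + 2 * (c - a) * ‖m' - m‖ ^ 2 := by
  induction N with
  | zero =>
    intro a c h m m'
    simp only [dyadicSq]
    have h1 : ‖meanOn b a c - m‖ ≤ ‖meanOn b a c - m'‖ + ‖m' - m‖ := by
      have := norm_add_le (meanOn b a c - m') (m' - m)
      rwa [sub_add_sub_cancel] at this
    have h2 : ‖meanOn b a c - m‖ ^ 2 ≤ 2 * ‖meanOn b a c - m'‖ ^ 2 + 2 * ‖m' - m‖ ^ 2 := by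
      nlinarith [norm_nonneg (meanOn b a c - m), sq_nonneg (‖meanOn b a c - m'‖ - ‖m' - m‖)]
    nlinarith
  | succ N ih =>
    intro a c h m m'
    simp only [dyadicSq]
    have h1 := ih (show a < (a + c) / 2 by linarith) m m'
    have h2 := ih (show (a + c) / 2 < c by linarith) m m'
    nlinarith

/-- A Calderon-Zygmund stopping-time argument run as an induction on the generation. While the mean
of |b - m| stays at most 4B, the interval is halved with m unchanged, and the integral on the right
is additive. Once the mean exceeds 4B, the interval is recentred at its own average. The integral
term, being larger than 4B times the length, pays for this, so the constants do not grow with N. -/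
lemma dyadicSq_le {b : ℝ → ℂ} (hb : MemBMO b) (N : ℕ) : ∀ {a c : ℝ}, a < c → ∀ m : ℂ,
    ∫ t in a..c, ‖b t - m‖ ≤ 4 * (bmoNorm b).toReal * (c - a) →
    dyadicSq b N a c m ≤ 16 * (bmoNorm b).toReal ^ 2 * (c - a) +
      72 * (bmoNorm b).toReal * ∫ t in a..c, ‖b t - m‖ := by
  set B := (bmoNorm b).toReal with hB
  have hB0 : 0 ≤ B := ENNReal.toReal_nonneg
  have hnn : ∀ {a c : ℝ}, a < c → ∀ m : ℂ, 0 ≤ ∫ t in a..c, ‖b t - m‖ := fun h m =>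
    intervalIntegral.integral_nonneg h.le fun _ _ => norm_nonneg _
  induction N with
  | zero =>
    intro a c h m hm
    simp only [dyadicSq]
    have h0 : 0 < c - a := by linarith
    have h1 := norm_meanOn_sub_le hb.1 h m
    have h2 : ‖meanOn b a c - m‖ ≤ 4 * B := by
      refine le_of_mul_le_mul_left ?_ h0
      linarith
    have h3 : ‖meanOn b a c - m‖ ^ 2 ≤ (4 * B) ^ 2 := by gcongr
    have := mul_nonneg hB0 (hnn h m)
    nlinarith
  | succ N ih =>
    -- Passing to a half at most doubles the mean of |b - m|, hence 8B in place of 4B.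
    have key : ∀ {a c : ℝ}, a < c → ∀ m : ℂ,
        ∫ t in a..c, ‖b t - m‖ ≤ 8 * B * (c - a) →
        dyadicSq b N a c m ≤ 16 * B ^ 2 * (c - a) + 72 * B * ∫ t in a..c, ‖b t - m‖ := by
      intro a c h m hm
      by_cases hs : ∫ t in a..c, ‖b t - m‖ ≤ 4 * B * (c - a)
      · exact ih h m hs
      push Not at hs
      have h0 : 0 < c - a := by linarith
      have h1 := norm_meanOn_sub_le hb.1 h m
      have h2 : ‖meanOn b a c - m‖ ≤ 8 * B := by
        refine le_of_mul_le_mul_left ?_ h0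
        linarith
      have h3 : ‖meanOn b a c - m‖ ^ 2 ≤ (8 * B) ^ 2 := by gcongr
      have h4 := integral_osc_le hb h
      rw [← hB] at h4
      have h5 := ih h (meanOn b a c) (by nlinarith)
      have h6 := dyadicSq_le_recenter b N h m (meanOn b a c)
      have h7 := mul_le_mul_of_nonneg_left h4 hB0
      have h8 := mul_le_mul_of_nonneg_left hs.le hB0
      have h9 := mul_le_mul_of_nonneg_left h3 h0.le
      -- Recentring costs 2(16 + 72)B² + 2·64B² = 304B² per unit length. Since the integral exceeds
      -- 4B per unit length, the right side is at least (16 + 4·72)B² = 304B²; this is what fixes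
      -- 72.
      nlinarith
    intro a c h m hm
    simp only [dyadicSq]
    have ha : a < (a + c) / 2 := by linarith
    have hc : (a + c) / 2 < c := by linarith
    have hadd := intervalIntegral.integral_add_adjacent_intervals
      (intervalIntegrable_norm_sub_const hb.1 m a ((a + c) / 2)) (intervalIntegrable_norm_sub_const hb.1 m ((a + c) / 2) c)
    have h1 := key ha m (by linarith [hnn hc m])
    have h2 := key hc m (by linarith [hnn ha m])
    rw [← hadd]
    linarith

/-- The dyadic averages of `b` of generation `N` on `[a, c]`, as a step function. -/
noncomputable def dyadicAvg (b : ℝ → ℂ) : ℕ → ℝ → ℝ → ℝ → ℂ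
  | 0, a, c, _ => meanOn b a c
  | N + 1, a, c, t =>
    if t ≤ (a + c) / 2 then dyadicAvg b N a ((a + c) / 2) t else dyadicAvg b N ((a + c) / 2) c t

lemma measurable_dyadicAvg (b : ℝ → ℂ) (N : ℕ) : ∀ a c : ℝ, Measurable (dyadicAvg b N a c) := by
  induction N with
  | zero => intro a c; exact measurable_const
  | succ N ih => intro a c; exact Measurable.ite measurableSet_Iic (ih _ _) (ih _ _)

lemma lintegral_dyadicAvg (b : ℝ → ℂ) (N : ℕ) (m : ℂ) : ∀ {a c : ℝ}, a < c →
    0 ≤ dyadicSq b N a c m ∧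
    ∫⁻ t in Ioc a c, ‖dyadicAvg b N a c t - m‖ₑ ^ 2 = ENNReal.ofReal (dyadicSq b N a c m) := by
  induction N with
  | zero =>
    intro a c h
    have : 0 ≤ c - a := by linarith
    simp only [dyadicAvg, dyadicSq, lintegral_const, Measure.restrict_apply MeasurableSet.univ,
      univ_inter, Real.volume_Ioc]
    refine ⟨by positivity, ?_⟩
    rw [ENNReal.ofReal_mul this, ENNReal.ofReal_pow (norm_nonneg _), ofReal_norm, mul_comm]
  | succ N ih =>
    intro a c h
    have ha : a < (a + c) / 2 := by linarith
    have hc : (a + c) / 2 < c := by linarith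
    obtain ⟨p1, e1⟩ := ih ha
    obtain ⟨p2, e2⟩ := ih hc
    simp only [dyadicSq]
    refine ⟨add_nonneg p1 p2, ?_⟩
    rw [ENNReal.ofReal_add p1 p2, ← e1, ← e2, ← Ioc_union_Ioc_eq_Ioc ha.le hc.le,
      lintegral_union measurableSet_Ioc (Ioc_disjoint_Ioc_of_le le_rfl)]
    congr 1
    · refine setLIntegral_congr_fun measurableSet_Ioc fun t ht => ?_
      simp [dyadicAvg, ht.2]
    · refine setLIntegral_congr_fun measurableSet_Ioc fun t ht => ?_
      simp [dyadicAvg, not_le.2 ht.1]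

/-- Exhibits the dyadic average as a mean over a ball containing t, the form needed by the Lebesgue
differentiation theorem with balls not centred at t. -/
lemma dyadicAvg_eq_meanOn (b : ℝ → ℂ) (N : ℕ) : ∀ {a c t : ℝ}, a ≤ t → t ≤ c →
    ∃ w : ℝ, |t - w| ≤ (c - a) / 2 ^ (N + 1) ∧ dyadicAvg b N a c t =
      meanOn b (w - (c - a) / 2 ^ (N + 1)) (w + (c - a) / 2 ^ (N + 1)) := by
  induction N with
  | zero =>
    intro a c t h1 h2
    refine ⟨(a + c) / 2, ?_, ?_⟩
    · rw [abs_le]; constructor <;> (norm_num; linarith)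
    · simp only [dyadicAvg]; congr 1 <;> ring
  | succ N ih =>
    intro a c t h1 h2
    have e1 : ((a + c) / 2 - a) / 2 ^ (N + 1) = (c - a) / 2 ^ (N + 1 + 1) := by
      field_simp; ring
    have e2 : (c - (a + c) / 2) / 2 ^ (N + 1) = (c - a) / 2 ^ (N + 1 + 1) := by
      field_simp; ring
    by_cases h : t ≤ (a + c) / 2
    · obtain ⟨w, hw⟩ := ih h1 h
      rw [e1] at hw
      exact ⟨w, by simpa [dyadicAvg, h] using hw⟩
    · obtain ⟨w, hw⟩ := ih (not_le.1 h).le h2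
      rw [e2] at hw
      exact ⟨w, by simpa [dyadicAvg, h] using hw⟩

lemma tendsto_dyadicAvg {b : ℝ → ℂ} (hb : LocallyIntegrable b volume) {a c : ℝ} (h : a < c) :
    ∀ᵐ t ∂(volume.restrict (Ioc a c)),
      Tendsto (fun N => dyadicAvg b N a c t) atTop (𝓝 (b t)) := by
  have h0 : 0 < c - a := by linarith
  rw [ae_restrict_iff' measurableSet_Ioc]
  filter_upwards [IsUnifLocDoublingMeasure.ae_tendsto_average (μ := volume) hb 1] with t ht hI
  choose w hw using fun N => dyadicAvg_eq_meanOn b N hI.1.le hI.2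
  have hd : Tendsto (fun N : ℕ => (c - a) / 2 ^ (N + 1)) atTop (𝓝[>] 0) := by
    refine tendsto_nhdsWithin_iff.2 ⟨?_, Eventually.of_forall fun N => ?_⟩
    · have := ((tendsto_pow_atTop_nhds_zero_of_lt_one (r := (1 / 2 : ℝ)) (by norm_num)
        (by norm_num)).comp (tendsto_add_atTop_nat 1)).const_mul (c - a)
      simpa [Function.comp_def, div_eq_mul_inv] using this
    · exact mem_Ioi.2 (by positivity)
  refine (ht w _ hd (Eventually.of_forall fun N => ?_)).congr fun N => ?_
  · rw [Metric.mem_closedBall, Real.dist_eq, one_mul]; exact (hw N).1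
  · have : 0 < (c - a) / 2 ^ (N + 1) := by positivity
    rw [(hw N).2, meanOn_eq_average b (by linarith), Real.closedBall_eq_Icc]

/-- The John-Nirenberg inequality in `L²`. -/
theorem lintegral_osc_sq_le {b : ℝ → ℂ} (hb : MemBMO b) {a c : ℝ} (h : a < c) :
    ∫⁻ t in Ioc a c, ‖b t - meanOn b a c‖ₑ ^ 2 ≤
      88 * bmoNorm b ^ 2 * ENNReal.ofReal (c - a) := by
  have h0 : 0 < c - a := by linarith
  have hB0 : 0 ≤ (bmoNorm b).toReal := ENNReal.toReal_nonneg
  have hN : ∀ N, ∫⁻ t in Ioc a c, ‖dyadicAvg b N a c t - meanOn b a c‖ₑ ^ 2 ≤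
      88 * bmoNorm b ^ 2 * ENNReal.ofReal (c - a) := by
    intro N
    rw [(lintegral_dyadicAvg b N _ h).2]
    have e : 88 * bmoNorm b ^ 2 * ENNReal.ofReal (c - a) =
        ENNReal.ofReal (88 * (bmoNorm b).toReal ^ 2 * (c - a)) := by
      rw [ENNReal.ofReal_mul (by positivity), ENNReal.ofReal_mul (by positivity),
        ENNReal.ofReal_pow hB0, ENNReal.ofReal_toReal hb.2.ne]
      norm_num
    rw [e]
    refine ENNReal.ofReal_le_ofReal ?_
    have h1 := integral_osc_le hb h
    have h2 := dyadicSq_le hb N h (meanOn b a c) (by nlinarith)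
    have h3 := mul_le_mul_of_nonneg_left h1 hB0
    nlinarith
  -- Fatou's lemma: dyadic averages converge almost everywhere to b, and their square deviations are
  -- bounded uniformly in N by 16 + 72 = 88.
  calc ∫⁻ t in Ioc a c, ‖b t - meanOn b a c‖ₑ ^ 2
      = ∫⁻ t in Ioc a c, liminf (fun N => ‖dyadicAvg b N a c t - meanOn b a c‖ₑ ^ 2) atTop := by
        refine lintegral_congr_ae ?_
        filter_upwards [tendsto_dyadicAvg hb.1 h] with t ht
        refine (Tendsto.liminf_eq ?_).symm
        exact (ENNReal.continuous_pow 2).continuousAt.tendsto.comp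
          ((ht.sub tendsto_const_nhds).enorm)
    _ ≤ liminf (fun N => ∫⁻ t in Ioc a c, ‖dyadicAvg b N a c t - meanOn b a c‖ₑ ^ 2) atTop := by
        refine lintegral_liminf_le fun N => ?_
        exact (((measurable_dyadicAvg b N a c).sub measurable_const).enorm).pow_const 2
    _ ≤ _ := by
        refine liminf_le_of_frequently_le' (Frequently.of_forall hN)

/-! ### Cauchy-Schwarz and the weighted Hardy inequality. -/

/-- Cauchy-Schwarz in the form `(∫ u)² ≤ (∫ p) (∫ q)` when `u² ≤ p q`. -/
lemma sq_lintegral_le_of_sq_le_mul {α : Type*} [MeasurableSpace α] {μ : Measure α}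
    {u p q : α → ENNReal} (hp : AEMeasurable p μ) (hq : AEMeasurable q μ)
    (h : ∀ᵐ a ∂μ, u a ^ 2 ≤ p a * q a) :
    (∫⁻ a, u a ∂μ) ^ 2 ≤ (∫⁻ a, p a ∂μ) * ∫⁻ a, q a ∂μ := by
  have e : ∀ z : ENNReal, (z ^ (1 / 2 : ℝ)) ^ (2 : ℝ) = z := fun z => by
    rw [← ENNReal.rpow_mul]; norm_num
  have e' : ∀ z : ENNReal, (z ^ 2) ^ (1 / 2 : ℝ) = z := fun z => by
    rw [← ENNReal.rpow_natCast, ← ENNReal.rpow_mul]; norm_num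
  have h1 : ∫⁻ a, u a ∂μ ≤ ∫⁻ a, ((fun a => p a ^ (1 / 2 : ℝ)) * fun a => q a ^ (1 / 2 : ℝ)) a ∂μ := by
    refine lintegral_mono_ae ?_
    filter_upwards [h] with a ha
    rw [Pi.mul_apply, ← ENNReal.mul_rpow_of_nonneg _ _ (by norm_num), ← e' (u a)]
    exact ENNReal.rpow_le_rpow ha (by norm_num)
  have h2 := h1.trans (ENNReal.lintegral_mul_le_Lp_mul_Lq μ (p := 2) (q := 2)
    (by rw [Real.holderConjugate_iff]; norm_num) (hp.pow_const _) (hq.pow_const _))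
  simp only [e] at h2
  calc (∫⁻ a, u a ∂μ) ^ 2
      ≤ ((∫⁻ a, p a ∂μ) ^ (1 / 2 : ℝ) * (∫⁻ a, q a ∂μ) ^ (1 / 2 : ℝ)) ^ 2 := by gcongr
    _ = _ := by
      rw [mul_pow, ← ENNReal.rpow_natCast, ← ENNReal.rpow_natCast, ← ENNReal.rpow_mul,
        ← ENNReal.rpow_mul]
      norm_num

lemma tsum_mul_half_pow (a : ENNReal) : ∑' k : ℕ, a * (2⁻¹ : ENNReal) ^ k = 2 * a := by
  rw [ENNReal.tsum_mul_left, ENNReal.tsum_geometric, ENNReal.one_sub_inv_two, inv_inv, mul_comm]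

lemma ofReal_mul_half_pow {a : ℝ} (ha : 0 ≤ a) (k : ℕ) :
    ENNReal.ofReal (a * (1 / 2) ^ k) = ENNReal.ofReal a * 2⁻¹ ^ k := by
  rw [ENNReal.ofReal_mul ha, ENNReal.ofReal_pow (by norm_num)]
  congr 2
  rw [one_div, ENNReal.ofReal_inv_of_pos (by norm_num)]; norm_num

lemma sqrt_four_pow_mul (k : ℕ) (s : ℝ) : √(4 ^ k * s) = 2 ^ k * √s := by
  rw [Real.sqrt_mul (by positivity), show (4 : ℝ) ^ k = (2 ^ k) ^ 2 by
    rw [← pow_mul, mul_comm, pow_mul]; norm_num, Real.sqrt_sq (by positivity)]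

/-- The k-th annulus has inner radius 4^k s, so its mass O(4^k s) times (4^k s)^(-3/2) decays like
2^(-k). Ratio 4 makes the series exactly geometric of ratio 1/2. -/
lemma lintegral_tail_le {w : ℝ → ENNReal} {x : ℝ} {A : ENNReal}
    (hw : ∀ r > 0, ∫⁻ y in {y | r ≤ |y - x| ∧ |y - x| < 4 * r}, w y ≤ A * ENNReal.ofReal r)
    {s : ℝ} (hs : 0 < s) :
    ∫⁻ y in {y | s ≤ |y - x|}, w y * ENNReal.ofReal (1 / (|y - x| * √|y - x|)) ≤
      2 * (A * ENNReal.ofReal (1 / √s)) := by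
  set S : ℕ → Set ℝ := fun k => {y | 4 ^ k * s ≤ |y - x| ∧ |y - x| < 4 * (4 ^ k * s)} with hS
  have hsub : {y | s ≤ |y - x|} ⊆ ⋃ k, S k := by
    intro y hy
    have hy' : s ≤ |y - x| := hy
    obtain ⟨k, h1, h2⟩ := exists_nat_pow_near (x := |y - x| / s) (y := (4 : ℝ))
      ((one_le_div hs).2 hy') (by norm_num)
    refine mem_iUnion.2 ⟨k, (le_div_iff₀ hs).1 h1, ?_⟩
    rw [div_lt_iff₀ hs] at h2
    linarith [show (4 : ℝ) ^ (k + 1) * s = 4 * (4 ^ k * s) by ring]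
  have hsm : ∀ k, MeasurableSet (S k) := fun k => by
    simp only [hS]; measurability
  calc _ ≤ ∫⁻ y in ⋃ k, S k, w y * ENNReal.ofReal (1 / (|y - x| * √|y - x|)) :=
        lintegral_mono_set hsub
    _ ≤ ∑' k, ∫⁻ y in S k, w y * ENNReal.ofReal (1 / (|y - x| * √|y - x|)) :=
        lintegral_iUnion_le _ _
    _ ≤ ∑' k : ℕ, A * ENNReal.ofReal (1 / √s) * 2⁻¹ ^ k := by
        refine ENNReal.tsum_le_tsum fun k => ?_
        have h4 : 0 < 4 ^ k * s := by positivity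
        calc _ ≤ ∫⁻ y in S k, w y * ENNReal.ofReal (1 / (4 ^ k * s * √(4 ^ k * s))) := by
              refine setLIntegral_mono' (hsm k) fun y hy => ?_
              have h5 : 4 ^ k * s ≤ |y - x| := hy.1
              gcongr
          _ = (∫⁻ y in S k, w y) * ENNReal.ofReal (1 / (4 ^ k * s * √(4 ^ k * s))) :=
              lintegral_mul_const' _ _ ofReal_ne_top
          _ ≤ A * ENNReal.ofReal (4 ^ k * s) *
                ENNReal.ofReal (1 / (4 ^ k * s * √(4 ^ k * s))) := by
              gcongr; exact hw _ h4
          _ = _ := by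
              rw [mul_assoc, mul_assoc A, ← ofReal_mul_half_pow (by positivity),
                ← ENNReal.ofReal_mul h4.le, sqrt_four_pow_mul]
              congr 2
              have := Real.sqrt_pos.2 hs
              rw [one_div_pow]
              field_simp
    _ = _ := tsum_mul_half_pow _

lemma lintegral_inv_sqrt_le (x : ℝ) {h : ℝ} (hh : 0 < h) :
    ∫⁻ t in {t | |t - x| ≤ h}, ENNReal.ofReal (1 / √|t - x|) ≤ 8 * ENNReal.ofReal (√h) := by
  set S : ℕ → Set ℝ := fun k => {t | h ≤ 4 ^ (k + 1) * |t - x| ∧ |t - x| ≤ h / 4 ^ k} with hS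
  have hsm : ∀ k, MeasurableSet (S k) := fun k => by
    simp only [hS]; measurability
  have hsub : ({t | |t - x| ≤ h} : Set ℝ) ⊆ {x} ∪ ⋃ k, S k := by
    intro t ht
    have ht' : |t - x| ≤ h := ht
    by_cases hx : t = x
    · exact Or.inl hx
    have h0 : 0 < |t - x| := abs_pos.2 (sub_ne_zero.2 hx)
    obtain ⟨k, h1, h2⟩ := exists_nat_pow_near (x := h / |t - x|) (y := (4 : ℝ))
      ((one_le_div h0).2 ht') (by norm_num)
    refine Or.inr (mem_iUnion.2 ⟨k, ((div_lt_iff₀ h0).1 h2).le, ?_⟩)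
    rw [le_div_iff₀ (by positivity)]
    rw [le_div_iff₀ h0] at h1
    linarith
  calc _ ≤ ∫⁻ t in {x} ∪ ⋃ k, S k, ENNReal.ofReal (1 / √|t - x|) := lintegral_mono_set hsub
    _ ≤ (∫⁻ t in {x}, ENNReal.ofReal (1 / √|t - x|)) +
          ∫⁻ t in ⋃ k, S k, ENNReal.ofReal (1 / √|t - x|) := lintegral_union_le _ _ _
    _ = ∫⁻ t in ⋃ k, S k, ENNReal.ofReal (1 / √|t - x|) := by simp
    _ ≤ ∑' k, ∫⁻ t in S k, ENNReal.ofReal (1 / √|t - x|) := lintegral_iUnion_le _ _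
    _ ≤ ∑' k : ℕ, ENNReal.ofReal (4 * √h) * 2⁻¹ ^ k := by
        refine ENNReal.tsum_le_tsum fun k => ?_
        calc _ ≤ ∫⁻ t in S k, ENNReal.ofReal (2 ^ (k + 1) / √h) := by
              refine setLIntegral_mono' (hsm k) fun t ht => ENNReal.ofReal_le_ofReal ?_
              have h1 : h ≤ 4 ^ (k + 1) * |t - x| := ht.1
              have h2 := Real.sqrt_le_sqrt h1
              rw [sqrt_four_pow_mul] at h2
              have h3 := Real.sqrt_pos.2 hh
              have h4 : 0 < √|t - x| := by
                by_contra hc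
                have : √|t - x| = 0 := le_antisymm (not_lt.1 hc) (Real.sqrt_nonneg _)
                rw [this] at h2; linarith
              rw [div_le_div_iff₀ h4 h3]; linarith
          _ = ENNReal.ofReal (2 ^ (k + 1) / √h) * volume (S k) := by simp
          _ ≤ ENNReal.ofReal (2 ^ (k + 1) / √h) * ENNReal.ofReal (2 * (h / 4 ^ k)) := by
              gcongr
              calc volume (S k) ≤ volume (Icc (x - h / 4 ^ k) (x + h / 4 ^ k)) := by
                    refine measure_mono fun t ht => ?_
                    have := abs_le.1 ht.2
                    exact ⟨by linarith, by linarith⟩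
                _ = _ := by rw [Real.volume_Icc]; congr 1; ring
          _ = _ := by
              rw [← ofReal_mul_half_pow (by positivity), ← ENNReal.ofReal_mul (by positivity)]
              congr 1
              have := Real.sqrt_pos.2 hh
              have h4 : (4 : ℝ) ^ k = 2 ^ k * 2 ^ k := by rw [← mul_pow]; norm_num
              rw [one_div_pow, h4, pow_succ]
              field_simp
              rw [Real.sq_sqrt hh.le]; ring
    _ = _ := by
        rw [tsum_mul_half_pow, ENNReal.ofReal_mul (by norm_num), ← mul_assoc]; norm_num

/-- Cauchy-Schwarz after inserting the power weight |t - x|^(1/2), whose inverse is integrable at x.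
This leaves room for the tail integral in y to converge after Tonelli. -/
lemma sq_lintegral_ball_le {φ : ℝ → ENNReal} (hφ : AEMeasurable φ volume) (x : ℝ) {h : ℝ}
    (hh : 0 < h) :
    (∫⁻ t in {t | |t - x| ≤ h}, φ t) ^ 2 ≤
      (∫⁻ t in {t | |t - x| ≤ h}, φ t ^ 2 * ENNReal.ofReal (√|t - x|)) *
        (8 * ENNReal.ofReal (√h)) := by
  refine (sq_lintegral_le_of_sq_le_mul (p := fun t => φ t ^ 2 * ENNReal.ofReal (√|t - x|))
    (q := fun t => ENNReal.ofReal (1 / √|t - x|)) ?_ ?_ ?_).trans ?_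
  · exact ((hφ.pow_const 2).mul (by fun_prop)).restrict
  · fun_prop
  · filter_upwards [ae_restrict_of_ae (Measure.ae_ne volume x)] with t ht
    have h4 : 0 < √|t - x| := Real.sqrt_pos.2 (abs_pos.2 (sub_ne_zero.2 ht))
    rw [mul_assoc, ← ENNReal.ofReal_mul h4.le, mul_one_div_cancel h4.ne']
    simp
  · gcongr; exact lintegral_inv_sqrt_le x hh

/-- A weighted Hardy inequality. -/
theorem lintegral_weighted_hardy {w φ : ℝ → ENNReal} (hwm : AEMeasurable w volume)
    (hφ : AEMeasurable φ volume) {x : ℝ} {A : ENNReal}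
    (hw : ∀ r > 0, ∫⁻ y in {y | r ≤ |y - x| ∧ |y - x| < 4 * r}, w y ≤ A * ENNReal.ofReal r) :
    ∫⁻ y, w y * (ENNReal.ofReal (1 / |y - x|) * ∫⁻ t in {t | |t - x| ≤ |y - x|}, φ t) ^ 2 ≤
      16 * A * ∫⁻ t, φ t ^ 2 := by
  set ρ : ℝ → ENNReal := fun y => ENNReal.ofReal (1 / (|y - x| * √|y - x|)) with hρ
  have hρm : Measurable ρ := by fun_prop
  set T : Set (ℝ × ℝ) := {p | |p.2 - x| ≤ |p.1 - x|} with hT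
  have hTm : MeasurableSet T := measurableSet_le (by fun_prop) (by fun_prop)
  set K : ℝ → ℝ → ENNReal := fun y t =>
    T.indicator 1 (y, t) * (w y * ρ y) * (φ t ^ 2 * ENNReal.ofReal (√|t - x|)) with hK
  have hψ : AEMeasurable (fun t => φ t ^ 2 * ENNReal.ofReal (√|t - x|)) volume :=
    (hφ.pow_const 2).mul (Measurable.aemeasurable (by fun_prop))
  have hKm : AEMeasurable (Function.uncurry K) (volume.prod volume) := by
    refine (((measurable_one.indicator hTm).aemeasurable.mul ?_).mul ?_)
    · exact (hwm.mul hρm.aemeasurable).comp_fst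
    · exact hψ.comp_snd
  have hball : ∀ y : ℝ, MeasurableSet {t | |t - x| ≤ |y - x|} := fun y =>
    measurableSet_le (by fun_prop) measurable_const
  have htail : ∀ t : ℝ, MeasurableSet {y | |t - x| ≤ |y - x|} := fun y =>
    measurableSet_le measurable_const (by fun_prop)
  calc _ ≤ ∫⁻ y, 8 * ∫⁻ t, K y t := by
        refine lintegral_mono_ae ?_
        filter_upwards [Measure.ae_ne volume x] with y hy
        have h0 : 0 < |y - x| := abs_pos.2 (sub_ne_zero.2 hy)
        have e : ∫⁻ t, K y t = w y * ρ y *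
            ∫⁻ t in {t | |t - x| ≤ |y - x|}, φ t ^ 2 * ENNReal.ofReal (√|t - x|) := by
          rw [← lintegral_indicator (hball y), ← lintegral_const_mul'']
          · refine lintegral_congr fun t => ?_
            by_cases ht : |t - x| ≤ |y - x| <;> simp [hK, hT, indicator, ht]
          · exact hψ.indicator (hball y)
        rw [e, mul_pow]
        calc _ ≤ w y * (ENNReal.ofReal (1 / |y - x|) ^ 2 *
              ((∫⁻ t in {t | |t - x| ≤ |y - x|}, φ t ^ 2 * ENNReal.ofReal (√|t - x|)) *
                (8 * ENNReal.ofReal (√|y - x|)))) := by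
              gcongr; exact sq_lintegral_ball_le hφ x h0
          _ = w y * (8 * (ENNReal.ofReal (1 / |y - x|) ^ 2 * ENNReal.ofReal (√|y - x|))) *
              (∫⁻ t in {t | |t - x| ≤ |y - x|}, φ t ^ 2 * ENNReal.ofReal (√|t - x|)) := by ring
          _ = _ := by
              have e2 : ENNReal.ofReal (1 / |y - x|) ^ 2 * ENNReal.ofReal (√|y - x|) = ρ y := by
                rw [← ENNReal.ofReal_pow (by positivity), ← ENNReal.ofReal_mul (by positivity)]
                simp only [hρ]
                congr 1
                have h1 := Real.sqrt_pos.2 h0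
                have h2 := Real.sq_sqrt h0.le
                field_simp
                rw [h2]
              rw [e2]; ring
    _ = 8 * ∫⁻ y, ∫⁻ t, K y t := lintegral_const_mul' _ _ (by norm_num)
    -- After the exchange, the y-integral is the tail of w(y)|y - x|^(-3/2) beyond |t - x|, at most
    -- 2A|t - x|^(-1/2), which cancels the inserted weight.
    _ = 8 * ∫⁻ t, ∫⁻ y, K y t := by rw [lintegral_lintegral_swap hKm]
    _ ≤ 8 * ∫⁻ t, 2 * A * φ t ^ 2 := by
        gcongr with t
        have e : ∫⁻ y, K y t = (∫⁻ y in {y | |t - x| ≤ |y - x|}, w y * ρ y) *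
            (φ t ^ 2 * ENNReal.ofReal (√|t - x|)) := by
          rw [← lintegral_indicator (htail t), ← lintegral_mul_const'']
          · refine lintegral_congr fun y => ?_
            by_cases ht : |t - x| ≤ |y - x| <;> simp [hK, hT, indicator, ht]
          · exact (hwm.mul hρm.aemeasurable).indicator (htail t)
        rw [e]
        rcases eq_or_ne t x with rfl | ht
        · simp
        have h0 : 0 < |t - x| := abs_pos.2 (sub_ne_zero.2 ht)
        have h1 := Real.sqrt_pos.2 h0
        calc _ ≤ 2 * (A * ENNReal.ofReal (1 / √|t - x|)) *
              (φ t ^ 2 * ENNReal.ofReal (√|t - x|)) := by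
              gcongr; exact lintegral_tail_le hw h0
          _ = 2 * A * φ t ^ 2 * (ENNReal.ofReal (1 / √|t - x|) * ENNReal.ofReal (√|t - x|)) := by
              ring
          _ = _ := by
              rw [← ENNReal.ofReal_mul (by positivity), one_div_mul_cancel h1.ne']; simp
    _ = _ := by
        rw [lintegral_const_mul'' _ (hφ.pow_const 2)]; ring

/-! ### Difference quotients, deviations from the mean, and their square bounds at fixed x. -/

/-- Absolute value of the difference quotient. -/
noncomputable def diffQuot (f : ℝ → ℂ) (x y : ℝ) : ENNReal := ‖(f x - f y) / ((x - y : ℝ) : ℂ)‖ₑ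

/-- Absolute deviation of `b y` from the mean of `b` between `x` and `y`. -/
noncomputable def avgDev (b : ℝ → ℂ) (x y : ℝ) : ENNReal := ‖b y - avg b x y‖ₑ

lemma enorm_div_real (z : ℂ) {h : ℝ} (hh : h ≠ 0) :
    ‖z / (h : ℂ)‖ₑ = ENNReal.ofReal (1 / |h|) * ‖z‖ₑ := by
  rw [← ofReal_norm, ← ofReal_norm, ← ENNReal.ofReal_mul (by positivity), norm_div,
    Complex.norm_real, Real.norm_eq_abs]
  congr 1; ring

lemma avg_comm (b : ℝ → ℂ) (x y : ℝ) : avg b x y = avg b y x := by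
  rw [avg, avg, intervalIntegral.integral_symm, neg_div, ← div_neg]
  congr 1; push_cast; ring

lemma diffQuot_comm (f : ℝ → ℂ) (x y : ℝ) : diffQuot f x y = diffQuot f y x := by
  rw [diffQuot, diffQuot, ← neg_sub, neg_div, ← div_neg]
  congr 2; push_cast; ring

lemma measurable_avg {b : ℝ → ℂ} (hb : LocallyIntegrable b volume) :
    Measurable (Function.uncurry (avg b)) := by
  have hc : Continuous fun x => ∫ t in (0 : ℝ)..x, b t :=
    intervalIntegral.continuous_primitive hb.intervalIntegrable_of_endpoints 0
  have e : Function.uncurry (avg b) = fun p : ℝ × ℝ =>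
      ((∫ t in (0 : ℝ)..p.1, b t) - ∫ t in (0 : ℝ)..p.2, b t) / ((p.1 - p.2 : ℝ) : ℂ) := by
    funext p
    simp only [Function.uncurry, avg]
    rw [intervalIntegral.integral_interval_sub_left (hb.intervalIntegrable_of_endpoints _ _) (hb.intervalIntegrable_of_endpoints _ _)]
  rw [e]
  exact ((hc.comp continuous_fst).sub (hc.comp continuous_snd)).measurable.div (by fun_prop)

lemma aemeasurable_avgDev {b : ℝ → ℂ} (hb : LocallyIntegrable b volume) :
    AEMeasurable (Function.uncurry (avgDev b)) (volume.prod volume) :=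
  (hb.aestronglyMeasurable.aemeasurable.comp_snd.sub (measurable_avg hb).aemeasurable).enorm

lemma aemeasurable_avgDev_right {b : ℝ → ℂ} (hb : LocallyIntegrable b volume) (x : ℝ) :
    AEMeasurable (avgDev b x) volume :=
  (hb.aestronglyMeasurable.aemeasurable.sub
    ((measurable_avg hb).comp measurable_prodMk_left).aemeasurable).enorm

lemma aemeasurable_avgDev_left {b : ℝ → ℂ} (hb : LocallyIntegrable b volume) (x : ℝ) :
    AEMeasurable (fun y => avgDev b y x) volume :=
  (measurable_const.aemeasurable.sub
    ((measurable_avg hb).comp (measurable_prodMk_right (y := x))).aemeasurable).enorm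

lemma measurable_diffQuot {f : ℝ → ℂ} (hf : Continuous f) :
    Measurable (Function.uncurry (diffQuot f)) := by
  have h : Measurable fun p : ℝ × ℝ => (f p.1 - f p.2) / ((p.1 - p.2 : ℝ) : ℂ) :=
    Measurable.div (by fun_prop) (by fun_prop)
  exact h.enorm

lemma measurable_diffQuot_right {f : ℝ → ℂ} (hf : Continuous f) (x : ℝ) :
    Measurable (diffQuot f x) :=
  (measurable_diffQuot hf).of_uncurry_left

lemma normL2_sq (g : ℝ → ℂ) : normL2 g ^ 2 = ∫⁻ t, ‖g t‖ₑ ^ 2 := by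
  rw [normL2, eLpNorm_eq_lintegral_rpow_enorm_toReal (by norm_num) (by norm_num),
    ← ENNReal.rpow_natCast, ← ENNReal.rpow_mul]
  simp

lemma enorm_intervalIntegral_le (b : ℝ → ℂ) (x y : ℝ) :
    ‖∫ t in y..x, b t‖ₑ ≤ ∫⁻ t in uIoc y x, ‖b t‖ₑ := by
  rw [← ofReal_norm, intervalIntegral.norm_intervalIntegral_eq, ofReal_norm]
  exact enorm_integral_le_lintegral_enorm _

lemma C1DerivL2.sub_eq {f : ℝ → ℂ} (hf : C1DerivL2 f) (x y : ℝ) :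
    f x - f y = ∫ t in y..x, deriv f t :=
  (intervalIntegral.integral_deriv_eq_sub (fun t _ => (hf.1.differentiable (by norm_num)) t)
    ((hf.1.continuous_deriv (by norm_num)).intervalIntegrable _ _)).symm

lemma diffQuot_le {f : ℝ → ℂ} (hf : C1DerivL2 f) (x y : ℝ) :
    diffQuot f x y ≤ ENNReal.ofReal (1 / |y - x|) *
      ∫⁻ t in {t | |t - x| ≤ |y - x|}, ‖deriv f t‖ₑ := by
  rcases eq_or_ne y x with rfl | h
  · simp [diffQuot]
  rw [diffQuot, enorm_div_real _ (sub_ne_zero.2 h.symm), abs_sub_comm x y]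
  gcongr
  rw [hf.sub_eq]
  refine (enorm_intervalIntegral_le _ _ _).trans (lintegral_mono_set fun t ht => ?_)
  rw [uIoc_comm] at ht
  have := abs_sub_left_of_mem_uIcc (uIoc_subset_uIcc ht)
  exact this

lemma lintegral_mul_diffQuot_sq_le {w : ℝ → ENNReal} (hwm : AEMeasurable w volume) {x : ℝ}
    {A : ENNReal}
    (hw : ∀ r > 0, ∫⁻ y in {y | r ≤ |y - x| ∧ |y - x| < 4 * r}, w y ≤ A * ENNReal.ofReal r)
    {f : ℝ → ℂ} (hf : C1DerivL2 f) :
    ∫⁻ y, w y * diffQuot f x y ^ 2 ≤ 16 * A * normL2 (deriv f) ^ 2 := by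
  rw [normL2_sq]
  refine le_trans ?_ (lintegral_weighted_hardy hwm hf.2.1.enorm hw)
  gcongr with y
  exact diffQuot_le hf x y

lemma annulus_subset (x r : ℝ) :
    {y | r ≤ |y - x| ∧ |y - x| < 4 * r} ⊆ Ioc (x - 4 * r) (x + 4 * r) := fun y hy => by
  have := abs_lt.1 hy.2
  exact ⟨by linarith, by linarith⟩

lemma lintegral_diffQuot_sq_le {f : ℝ → ℂ} (hf : C1DerivL2 f) (x : ℝ) :
    ∫⁻ y, diffQuot f x y ^ 2 ≤ 128 * normL2 (deriv f) ^ 2 := by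
  have h := lintegral_mul_diffQuot_sq_le (w := fun _ => 1) (x := x) (A := 8) aemeasurable_const
    (fun r hr => ?_) hf
  · simp only [one_mul] at h
    refine h.trans (le_of_eq ?_)
    norm_num
  · rw [lintegral_one, Measure.restrict_apply_univ]
    refine (measure_mono (annulus_subset x r)).trans (le_of_eq ?_)
    rw [Real.volume_Ioc, show x + 4 * r - (x - 4 * r) = 8 * r by ring,
      ENNReal.ofReal_mul (by norm_num)]
    norm_num

/-- The interval between x and y has length at least r and lies in the one of length 8r, so passing
to the larger one costs a factor 8. -/
lemma enorm_avg_sub_meanOn_le {b : ℝ → ℂ} (hb : MemBMO b) {x y r : ℝ} (hr : 0 < r)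
    (hy : y ∈ {y | r ≤ |y - x| ∧ |y - x| < 4 * r}) :
    ‖avg b x y - meanOn b (x - 4 * r) (x + 4 * r)‖ₑ ≤ 8 * bmoNorm b := by
  set m := meanOn b (x - 4 * r) (x + 4 * r)
  have h0 : r ≤ |x - y| := by rw [abs_sub_comm]; exact hy.1
  have hxy : x - y ≠ 0 := fun h => by rw [h, abs_zero] at h0; linarith
  have e : avg b x y - m = (∫ t in y..x, (b t - m)) / ((x - y : ℝ) : ℂ) := by
    have h1 : ((x - y : ℝ) : ℂ) ≠ 0 := Complex.ofReal_ne_zero.2 hxy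
    rw [intervalIntegral.integral_sub (hb.1.intervalIntegrable_of_endpoints _ _) intervalIntegrable_const,
      intervalIntegral.integral_const, avg, Complex.real_smul, sub_div, mul_div_cancel_left₀ _ h1]
  rw [e, enorm_div_real _ hxy]
  calc _ ≤ ENNReal.ofReal (1 / r) * (bmoNorm b * ENNReal.ofReal (8 * r)) := by
        gcongr
        refine (enorm_intervalIntegral_le _ _ _).trans ?_
        have h := lintegral_osc_le (b := b) (show x - 4 * r < x + 4 * r by linarith)
        rw [show x + 4 * r - (x - 4 * r) = 8 * r by ring] at h
        refine le_trans (lintegral_mono_set fun t ht => ?_) h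
        have h2 := abs_lt.1 hy.2
        have h3 := uIoc_subset_uIcc ht
        refine uIcc_subset_Icc ?_ ?_ h3
        · exact ⟨by linarith, by linarith⟩
        · exact ⟨by linarith, by linarith⟩
    _ = (ENNReal.ofReal (1 / r) * ENNReal.ofReal (8 * r)) * bmoNorm b := by ring
    _ = _ := by
        rw [← ENNReal.ofReal_mul (by positivity), show 1 / r * (8 * r) = 8 by field_simp]
        norm_num

lemma add_sq_le_two_mul (u v : ENNReal) : (u + v) ^ 2 ≤ 2 * u ^ 2 + 2 * v ^ 2 := by
  have h := ENNReal.rpow_add_le_mul_rpow_add_rpow u v (p := 2) (by norm_num)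
  norm_num at h
  rwa [mul_add] at h

lemma lintegral_annulus_avgDev_sq_le {b : ℝ → ℂ} (hb : MemBMO b) (x : ℝ) {r : ℝ} (hr : 0 < r) :
    ∫⁻ y in {y | r ≤ |y - x| ∧ |y - x| < 4 * r}, avgDev b x y ^ 2 ≤
      2432 * bmoNorm b ^ 2 * ENNReal.ofReal r := by
  set m := meanOn b (x - 4 * r) (x + 4 * r) with hm
  have hS : MeasurableSet {y | r ≤ |y - x| ∧ |y - x| < 4 * r} := by measurability
  calc _ ≤ ∫⁻ y in {y | r ≤ |y - x| ∧ |y - x| < 4 * r},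
          (2 * ‖b y - m‖ₑ ^ 2 + 2 * (8 * bmoNorm b) ^ 2) := by
        refine setLIntegral_mono' hS fun y hy => ?_
        refine le_trans ?_ (add_sq_le_two_mul _ _)
        have h1 := enorm_avg_sub_meanOn_le hb hr hy
        gcongr
        calc avgDev b x y = ‖(b y - m) - (avg b x y - m)‖ₑ := by rw [avgDev]; congr 1; ring
          _ ≤ ‖b y - m‖ₑ + ‖avg b x y - m‖ₑ := enorm_sub_le
          _ ≤ _ := by gcongr
    _ ≤ ∫⁻ y in Ioc (x - 4 * r) (x + 4 * r),
          (2 * ‖b y - m‖ₑ ^ 2 + 2 * (8 * bmoNorm b) ^ 2) := lintegral_mono_set (annulus_subset x r)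
    _ = 2 * (∫⁻ y in Ioc (x - 4 * r) (x + 4 * r), ‖b y - m‖ₑ ^ 2) +
          2 * (8 * bmoNorm b) ^ 2 * ENNReal.ofReal (8 * r) := by
        rw [lintegral_add_right _ measurable_const, lintegral_const_mul' _ _ (by norm_num),
          lintegral_const, Measure.restrict_apply_univ, Real.volume_Ioc,
          show x + 4 * r - (x - 4 * r) = 8 * r by ring]
    _ ≤ 2 * (88 * bmoNorm b ^ 2 * ENNReal.ofReal (8 * r)) +
          2 * (8 * bmoNorm b) ^ 2 * ENNReal.ofReal (8 * r) := by
        have h := lintegral_osc_sq_le hb (show x - 4 * r < x + 4 * r by linarith)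
        rw [show x + 4 * r - (x - 4 * r) = 8 * r by ring] at h
        gcongr
    _ = _ := by
        rw [ENNReal.ofReal_mul (by norm_num), ENNReal.ofReal_ofNat]; ring

lemma lintegral_avgDev_sq_diffQuot_sq_le {b : ℝ → ℂ} (hb : MemBMO b) {f : ℝ → ℂ}
    (hf : C1DerivL2 f) (x : ℝ) :
    ∫⁻ y, avgDev b x y ^ 2 * diffQuot f x y ^ 2 ≤
      38912 * bmoNorm b ^ 2 * normL2 (deriv f) ^ 2 := by
  refine (lintegral_mul_diffQuot_sq_le (A := 2432 * bmoNorm b ^ 2)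
    ((aemeasurable_avgDev_right hb.1 x).pow_const 2)
    (fun r hr => lintegral_annulus_avgDev_sq_le hb x hr) hf).trans (le_of_eq ?_)
  ring

lemma le_of_pow_two_le_pow_two {u v : ENNReal} (h : u ^ 2 ≤ v ^ 2) : u ≤ v :=
  (ENNReal.pow_le_pow_left_iff two_ne_zero).1 h

/-! ### Integrals of the product kernels, and the L² operator bound. -/

lemma lintegral_diffQuot_mul_le {f₁ f₂ : ℝ → ℂ} (h₁ : C1DerivL2 f₁) (h₂ : C1DerivL2 f₂) (x : ℝ) :
    ∫⁻ y, diffQuot f₁ x y * diffQuot f₂ x y ≤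
      40000 * (normL2 (deriv f₁) * normL2 (deriv f₂)) := by
  refine le_of_pow_two_le_pow_two ((sq_lintegral_le_of_sq_le_mul
    (p := fun y => diffQuot f₁ x y ^ 2) (q := fun y => diffQuot f₂ x y ^ 2)
    ((measurable_diffQuot_right h₁.1.continuous x).pow_const 2).aemeasurable
    ((measurable_diffQuot_right h₂.1.continuous x).pow_const 2).aemeasurable
    (ae_of_all _ fun y => (mul_pow _ _ _).le)).trans ?_)
  calc _ ≤ (40000 * normL2 (deriv f₁) ^ 2) * (40000 * normL2 (deriv f₂) ^ 2) :=
        mul_le_mul' ((lintegral_diffQuot_sq_le h₁ x).trans (by gcongr; norm_num))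
          ((lintegral_diffQuot_sq_le h₂ x).trans (by gcongr; norm_num))
    _ = _ := by ring

lemma lintegral_avgDev_sq_mul_le {b : ℝ → ℂ} (hb : MemBMO b) {f₁ f₂ : ℝ → ℂ}
    (h₁ : C1DerivL2 f₁) (h₂ : C1DerivL2 f₂) (x : ℝ) :
    ∫⁻ y, avgDev b x y ^ 2 * (diffQuot f₁ x y * diffQuot f₂ x y) ≤
      40000 * (bmoNorm b ^ 2 * (normL2 (deriv f₁) * normL2 (deriv f₂))) := by
  have hm := (aemeasurable_avgDev_right hb.1 x).pow_const 2
  refine le_of_pow_two_le_pow_two ((sq_lintegral_le_of_sq_le_mul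
    (p := fun y => avgDev b x y ^ 2 * diffQuot f₁ x y ^ 2)
    (q := fun y => avgDev b x y ^ 2 * diffQuot f₂ x y ^ 2)
    (hm.mul ((measurable_diffQuot_right h₁.1.continuous x).pow_const 2).aemeasurable)
    (hm.mul ((measurable_diffQuot_right h₂.1.continuous x).pow_const 2).aemeasurable)
    (ae_of_all _ fun y => le_of_eq (by ring))).trans ?_)
  calc _ ≤ (40000 * bmoNorm b ^ 2 * normL2 (deriv f₁) ^ 2) *
        (40000 * bmoNorm b ^ 2 * normL2 (deriv f₂) ^ 2) :=
        mul_le_mul' ((lintegral_avgDev_sq_diffQuot_sq_le hb h₁ x).trans (by gcongr; norm_num))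
          ((lintegral_avgDev_sq_diffQuot_sq_le hb h₂ x).trans (by gcongr; norm_num))
    _ = _ := by ring

lemma aemeasurable_diffQuot_mul_right {f₁ f₂ : ℝ → ℂ} (h₁ : C1DerivL2 f₁) (h₂ : C1DerivL2 f₂)
    (x : ℝ) : AEMeasurable (fun y => diffQuot f₁ x y * diffQuot f₂ x y) volume :=
  ((measurable_diffQuot_right h₁.1.continuous x).mul
    (measurable_diffQuot_right h₂.1.continuous x)).aemeasurable

/-- Interpolates by Cauchy-Schwarz between the bounds for the powers 0 and 2 of the deviation. -/
lemma lintegral_avgDev_mul_le {b : ℝ → ℂ} (hb : MemBMO b) {f₁ f₂ : ℝ → ℂ}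
    (h₁ : C1DerivL2 f₁) (h₂ : C1DerivL2 f₂) (x : ℝ) :
    ∫⁻ y, avgDev b x y * (diffQuot f₁ x y * diffQuot f₂ x y) ≤
      40000 * (bmoNorm b * (normL2 (deriv f₁) * normL2 (deriv f₂))) := by
  have hm := aemeasurable_diffQuot_mul_right h₁ h₂ x
  refine le_of_pow_two_le_pow_two ((sq_lintegral_le_of_sq_le_mul
    (p := fun y => avgDev b x y ^ 2 * (diffQuot f₁ x y * diffQuot f₂ x y))
    (((aemeasurable_avgDev_right hb.1 x).pow_const 2).mul hm) hm
    (ae_of_all _ fun y => le_of_eq (by ring))).trans ?_)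
  refine (mul_le_mul' (lintegral_avgDev_sq_mul_le hb h₁ h₂ x)
    (lintegral_diffQuot_mul_le h₁ h₂ x)).trans (le_of_eq ?_)
  ring

/-- The common `L²` estimate behind the bilinear inequalities. -/
theorem lintegral_sq_kernel_le {b : ℝ → ℂ} (hb : MemBMO b) {f₁ f₂ : ℝ → ℂ}
    (h₁ : C1DerivL2 f₁) (h₂ : C1DerivL2 f₂) {G : ℝ → ENNReal} (hG : AEMeasurable G volume) :
    ∫⁻ x, (∫⁻ y, (avgDev b x y + avgDev b y x) * (diffQuot f₁ x y * diffQuot f₂ x y) * G y) ^ 2 ≤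
      (80000 * (bmoNorm b * (normL2 (deriv f₁) * normL2 (deriv f₂)))) ^ 2 * ∫⁻ y, G y ^ 2 := by
  set B := bmoNorm b
  set N := normL2 (deriv f₁) * normL2 (deriv f₂) with hN
  have hBt : B ≠ ⊤ := hb.2.ne
  have hNt : N ≠ ⊤ := ENNReal.mul_ne_top h₁.2.2.ne h₂.2.2.ne
  set W : ℝ → ℝ → ENNReal := fun x y => diffQuot f₁ x y * diffQuot f₂ x y with hW
  have hWm : Measurable (Function.uncurry W) :=
    (measurable_diffQuot h₁.1.continuous).mul (measurable_diffQuot h₂.1.continuous)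
  have hWx := fun x => aemeasurable_diffQuot_mul_right h₁ h₂ x
  have hWc : ∀ x y, W x y = W y x := fun x y => by
    simp only [hW]; rw [diffQuot_comm f₁, diffQuot_comm f₂]
  have hD := aemeasurable_avgDev hb.1
  have hD' : AEMeasurable (fun p : ℝ × ℝ => avgDev b p.2 p.1) (volume.prod volume) := by
    exact hD.comp_quasiMeasurePreserving
      (Measure.measurePreserving_swap (μ := volume) (ν := volume)).quasiMeasurePreserving
  have hG2 := hG.pow_const 2
  have hU : ∫⁻ x, (∫⁻ y, avgDev b x y * W x y * G y) ^ 2 ≤ (40000 * (B * N)) ^ 2 * ∫⁻ y, G y ^ 2 := by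
    -- The deviation at y is attached to the factor without G, where the bound uniform in x absorbs
    -- it.
    calc _ ≤ ∫⁻ x, 40000 * (B ^ 2 * N) * ∫⁻ y, W x y * G y ^ 2 := by
          refine lintegral_mono fun x => ?_
          refine (sq_lintegral_le_of_sq_le_mul
            (((aemeasurable_avgDev_right hb.1 x).pow_const 2).mul (hWx x))
            ((hWx x).mul hG2) (ae_of_all _ fun y => le_of_eq ?_)).trans
            (mul_le_mul' (lintegral_avgDev_sq_mul_le hb h₁ h₂ x) le_rfl)
          simp only [Pi.mul_apply, hW]; ring
      _ = 40000 * (B ^ 2 * N) * ∫⁻ y, ∫⁻ x, W x y * G y ^ 2 := by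
          rw [lintegral_const_mul' _ _ (by finiteness), lintegral_lintegral_swap]
          exact hWm.aemeasurable.mul hG2.comp_snd
      _ ≤ 40000 * (B ^ 2 * N) * ∫⁻ y, 40000 * N * G y ^ 2 := by
          gcongr with y
          rw [lintegral_mul_const'' _ ((hWx y).congr (ae_of_all _ fun x => hWc y x))]
          gcongr
          simp only [hWc _ y]
          exact lintegral_diffQuot_mul_le h₁ h₂ y
      _ = _ := by rw [lintegral_const_mul'' _ hG2]; ring
  have hV : ∫⁻ x, (∫⁻ y, avgDev b y x * W x y * G y) ^ 2 ≤ (40000 * (B * N)) ^ 2 * ∫⁻ y, G y ^ 2 := by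
    -- Here the deviation is at x, so it goes with G instead: after Tonelli its square is integrated
    -- in x at fixed y.
    calc _ ≤ ∫⁻ x, 40000 * N * ∫⁻ y, avgDev b y x ^ 2 * W x y * G y ^ 2 := by
          refine lintegral_mono fun x => ?_
          refine (sq_lintegral_le_of_sq_le_mul (hWx x)
            ((((aemeasurable_avgDev_left hb.1 x).pow_const 2).mul (hWx x)).mul hG2)
            (ae_of_all _ fun y => le_of_eq ?_)).trans
            (mul_le_mul' (lintegral_diffQuot_mul_le h₁ h₂ x) le_rfl)
          simp only [Pi.mul_apply, hW]; ring
      _ = 40000 * N * ∫⁻ y, ∫⁻ x, avgDev b y x ^ 2 * W x y * G y ^ 2 := by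
          rw [lintegral_const_mul' _ _ (by finiteness), lintegral_lintegral_swap]
          exact ((hD'.pow_const 2).mul hWm.aemeasurable).mul hG2.comp_snd
      _ ≤ 40000 * N * ∫⁻ y, 40000 * (B ^ 2 * N) * G y ^ 2 := by
          gcongr with y
          simp only [hWc _ y]
          have hm : AEMeasurable (fun x => avgDev b y x ^ 2 * W y x) volume :=
            ((aemeasurable_avgDev_right hb.1 y).pow_const 2).mul (hWx y)
          rw [lintegral_mul_const'' _ hm]
          gcongr
          exact lintegral_avgDev_sq_mul_le hb h₁ h₂ y
      _ = _ := by rw [lintegral_const_mul'' _ hG2]; ring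
  have hK : AEMeasurable (Function.uncurry fun x y => avgDev b x y * W x y * G y)
      (volume.prod volume) := (hD.mul hWm.aemeasurable).mul hG.comp_snd
  calc _ ≤ ∫⁻ x, (2 * (∫⁻ y, avgDev b x y * W x y * G y) ^ 2 +
          2 * (∫⁻ y, avgDev b y x * W x y * G y) ^ 2) := by
        refine lintegral_mono fun x => le_trans ?_ (add_sq_le_two_mul _ _)
        have hm : AEMeasurable (fun y => avgDev b x y * W x y * G y) volume :=
          ((aemeasurable_avgDev_right hb.1 x).mul (hWx x)).mul hG
        rw [← lintegral_add_left' hm]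
        gcongr with y
        exact le_of_eq (by simp only [hW]; ring)
    _ = 2 * (∫⁻ x, (∫⁻ y, avgDev b x y * W x y * G y) ^ 2) +
          2 * ∫⁻ x, (∫⁻ y, avgDev b y x * W x y * G y) ^ 2 := by
        have hm : AEMeasurable (fun x => 2 * (∫⁻ y, avgDev b x y * W x y * G y) ^ 2) volume :=
          (hK.lintegral_prod_right'.pow_const 2).const_mul 2
        rw [lintegral_add_left' hm,
          lintegral_const_mul' _ _ (by norm_num), lintegral_const_mul' _ _ (by norm_num)]
    _ ≤ 2 * ((40000 * (B * N)) ^ 2 * ∫⁻ y, G y ^ 2) +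
          2 * ((40000 * (B * N)) ^ 2 * ∫⁻ y, G y ^ 2) := by gcongr
    _ = _ := by ring

/-! ### The maximal function: measurability, finiteness and the L² bound. -/

lemma lt_maximalFn_iff {f : ℝ → ℂ} {x : ℝ} {s : ENNReal} : s < maximalFn f x ↔
    ∃ a c : ℝ, a < c ∧ x ∈ Icc a c ∧ s * ENNReal.ofReal (c - a) < ∫⁻ t in Icc a c, ‖f t‖ₑ := by
  simp only [maximalFn, lt_iSup_iff]
  refine exists_congr fun a => exists_congr fun c => ?_
  constructor
  · rintro ⟨h, hx, hs⟩
    refine ⟨h, hx, ?_⟩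
    rw [setLAverage_eq, Real.volume_Icc] at hs
    exact (ENNReal.lt_div_iff_mul_lt (Or.inl (by simpa using h)) (Or.inl ofReal_ne_top)).1 hs
  · rintro ⟨h, hx, hs⟩
    refine ⟨h, hx, ?_⟩
    rw [setLAverage_eq, Real.volume_Icc]
    exact (ENNReal.lt_div_iff_mul_lt (Or.inl (by simpa using h)) (Or.inl ofReal_ne_top)).2 hs

/-- A slight enlargement of a witnessing interval still witnesses, and it contains a neighbourhood
of x. -/
lemma isOpen_lt_maximalFn (f : ℝ → ℂ) (s : ENNReal) : IsOpen {x | s < maximalFn f x} := by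
  rw [Metric.isOpen_iff]
  intro x hx
  have hs : s ≠ ⊤ := (lt_of_lt_of_le hx le_top).ne
  obtain ⟨a, c, h, hxI, hJ⟩ := lt_maximalFn_iff.1 hx
  have ht : Tendsto (fun ε : ℝ => s * ENNReal.ofReal ((c + ε) - (a - ε))) (𝓝[>] 0)
      (𝓝 (s * ENNReal.ofReal (c - a))) := by
    refine ENNReal.Tendsto.const_mul ?_ (Or.inr hs)
    refine ENNReal.tendsto_ofReal (tendsto_nhdsWithin_of_tendsto_nhds ?_)
    have : Continuous fun ε : ℝ => (c + ε) - (a - ε) := by fun_prop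
    simpa using this.tendsto 0
  obtain ⟨ε, hε, hpos⟩ := ((ht.eventually_lt_const hJ).and self_mem_nhdsWithin).exists
  have hpos : 0 < ε := hpos
  refine ⟨ε, hpos, fun z hz => lt_maximalFn_iff.2 ⟨a - ε, c + ε, by linarith, ?_, ?_⟩⟩
  · have := abs_lt.1 (Real.dist_eq z x ▸ Metric.mem_ball.1 hz)
    exact ⟨by linarith [hxI.1], by linarith [hxI.2]⟩
  · exact hε.trans_le (lintegral_mono_set (Icc_subset_Icc (by linarith) (by linarith)))

lemma measurable_maximalFn (f : ℝ → ℂ) : Measurable (maximalFn f) :=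
  measurable_of_Ioi fun s => (isOpen_lt_maximalFn f s).measurableSet

lemma lintegral_le_maximalFn_mul (f : ℝ → ℂ) {a c x : ℝ} (h : a < c) (hx : x ∈ Icc a c) :
    ∫⁻ t in Icc a c, ‖f t‖ₑ ≤ maximalFn f x * ENNReal.ofReal (c - a) := by
  by_contra hc
  exact lt_irrefl _ (lt_maximalFn_iff.2 ⟨a, c, h, hx, not_le.1 hc⟩)

/-- The freedom in z matters: z = y gives the norm estimates, z = x the absolute convergence in the
last one. -/
lemma diffQuot_le_maximalFn {f : ℝ → ℂ} (hf : C1DerivL2 f) {x y z : ℝ} (hz : z ∈ uIcc y x) :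
    diffQuot f x y ≤ maximalFn (deriv f) z := by
  rcases eq_or_ne x y with rfl | h
  · simp [diffQuot]
  have h' : min y x < max y x := min_lt_max.2 h.symm
  have hd : |x - y| = max y x - min y x := by rw [max_sub_min_eq_abs]
  have h0 : 0 < |x - y| := abs_pos.2 (sub_ne_zero.2 h)
  rw [diffQuot, enorm_div_real _ (sub_ne_zero.2 h), hf.sub_eq]
  calc _ ≤ ENNReal.ofReal (1 / |x - y|) *
        (maximalFn (deriv f) z * ENNReal.ofReal (max y x - min y x)) := by
        gcongr
        refine (enorm_intervalIntegral_le _ _ _).trans ?_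
        exact (lintegral_mono_set uIoc_subset_uIcc).trans (lintegral_le_maximalFn_mul _ h' hz)
    _ = (ENNReal.ofReal (1 / |x - y|) * ENNReal.ofReal |x - y|) * maximalFn (deriv f) z := by
        rw [hd]; ring
    _ = _ := by
        rw [← ENNReal.ofReal_mul (by positivity), one_div_mul_cancel h0.ne']; simp

lemma sq_lintegral_Icc_le {f : ℝ → ℂ} (hf : AEStronglyMeasurable f volume) (a c : ℝ) :
    (∫⁻ t in Icc a c, ‖f t‖ₑ) ^ 2 ≤ (∫⁻ t, ‖f t‖ₑ ^ 2) * ENNReal.ofReal (c - a) := by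
  refine (sq_lintegral_le_of_sq_le_mul (p := fun t => ‖f t‖ₑ ^ 2) (q := fun _ => 1)
    (hf.enorm.pow_const 2).restrict aemeasurable_const (ae_of_all _ fun t => by simp)).trans ?_
  rw [lintegral_one, Measure.restrict_apply_univ, Real.volume_Icc]
  gcongr
  exact Measure.restrict_le_self

/-- Intervals of length at most 1 are controlled by local boundedness, longer ones by Cauchy-Schwarz
and the L² norm. Finiteness thus holds at every point. -/
lemma maximalFn_lt_top {f : ℝ → ℂ} (hc : Continuous f) (hf : MemLp f 2 volume) (x : ℝ) :
    maximalFn f x < ⊤ := by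
  obtain ⟨K, hK⟩ := (isCompact_Icc (a := x - 1) (b := x + 1)).exists_bound_of_continuousOn
    hc.continuousOn
  have hN : normL2 f < ⊤ := hf.2
  refine lt_of_le_of_lt (b := ENNReal.ofReal K + normL2 f) ?_ (by finiteness)
  by_contra hlt
  obtain ⟨a, c, h, hx, hJ⟩ := lt_maximalFn_iff.1 (not_le.1 hlt)
  refine absurd hJ (not_lt.2 ?_)
  by_cases hl : c - a ≤ 1
  · calc ∫⁻ t in Icc a c, ‖f t‖ₑ ≤ ∫⁻ t in Icc a c, ENNReal.ofReal K := by
          refine setLIntegral_mono' measurableSet_Icc fun t ht => ?_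
          rw [← ofReal_norm]
          exact ENNReal.ofReal_le_ofReal
            (hK t ⟨by linarith [ht.1, hx.2], by linarith [ht.2, hx.1]⟩)
      _ = ENNReal.ofReal K * ENNReal.ofReal (c - a) := by simp
      _ ≤ _ := by gcongr; exact le_self_add
  · calc ∫⁻ t in Icc a c, ‖f t‖ₑ ≤ normL2 f * ENNReal.ofReal (c - a) := by
          refine le_of_pow_two_le_pow_two ((sq_lintegral_Icc_le hf.1 a c).trans ?_)
          rw [mul_pow, normL2_sq]
          gcongr
          refine le_self_pow₀ ?_ two_ne_zero
          rw [← ENNReal.ofReal_one]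
          exact ENNReal.ofReal_le_ofReal (not_le.1 hl).le
      _ ≤ _ := by gcongr; exact le_add_self

/-- Weak type estimate for the maximal function. -/
lemma mul_volume_lt_maximalFn_le {f : ℝ → ℂ} (hm : Measurable f) (hf : MemLp f 2 volume) {s : ℝ}
    (hs : 0 < s) :
    ENNReal.ofReal s * volume {x | ENNReal.ofReal s < maximalFn f x} ≤
      10 * ∫⁻ t in {t | s < 2 * ‖f t‖}, ‖f t‖ₑ := by
  set T : Set (ℝ × ℝ) := {p | p.1 < p.2 ∧
    ENNReal.ofReal s * ENNReal.ofReal (p.2 - p.1) < ∫⁻ t in Icc p.1 p.2, ‖f t‖ₑ} with hT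
  have hN : ∫⁻ t, ‖f t‖ₑ ^ 2 ≠ ⊤ := by
    rw [← normL2_sq]; exact ENNReal.pow_ne_top hf.2.ne
  set R : ℝ := (∫⁻ t, ‖f t‖ₑ ^ 2).toReal / s ^ 2 with hR
  have hball : ∀ p : ℝ × ℝ,
      Metric.closedBall ((p.1 + p.2) / 2) ((p.2 - p.1) / 2) = Icc p.1 p.2 := fun p => by
    rw [Real.closedBall_eq_Icc]; congr 1 <;> ring
  -- Cauchy-Schwarz gives s²L² ≤ ‖f‖₂² L for an interval of length L in `T`; Vitali's covering lemma
  -- needs such a bound on the radii.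
  have hrad : ∀ p ∈ T, (p.2 - p.1) / 2 ≤ R := by
    intro p hp
    have h0 : 0 < p.2 - p.1 := by linarith [hp.1]
    have h1 : (ENNReal.ofReal s * ENNReal.ofReal (p.2 - p.1)) ^ 2 ≤
        (∫⁻ t, ‖f t‖ₑ ^ 2) * ENNReal.ofReal (p.2 - p.1) :=
      (pow_le_pow_left' hp.2.le 2).trans (sq_lintegral_Icc_le hf.1 _ _)
    have h2 := ENNReal.toReal_mono (ENNReal.mul_ne_top hN ofReal_ne_top) h1
    rw [ENNReal.toReal_pow, ENNReal.toReal_mul, ENNReal.toReal_mul, ENNReal.toReal_ofReal hs.le,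
      ENNReal.toReal_ofReal h0.le, mul_pow, sq (p.2 - p.1), ← mul_assoc] at h2
    have h3 := le_of_mul_le_mul_right h2 h0
    have h4 : p.2 - p.1 ≤ R := by rw [hR, le_div_iff₀ (by positivity)]; linarith
    linarith
  obtain ⟨u, huT, hdisj, hcov⟩ := Vitali.exists_disjoint_subfamily_covering_enlargement_closedBall
    T (fun p => (p.1 + p.2) / 2) (fun p => (p.2 - p.1) / 2) R hrad 5 (by norm_num)
  simp only [hball] at hdisj hcov
  have hcount : u.Countable := hdisj.countable_of_nonempty_interior fun p hp => by
    rw [interior_Icc]; exact nonempty_Ioo.2 (huT hp).1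
  have hE : MeasurableSet {t | s < 2 * ‖f t‖} := measurableSet_lt measurable_const (by fun_prop)
  -- Values with |f| ≤ s/2 account for at most half of the lower bound sL; the remaining half comes
  -- from the large values.
  have hlen : ∀ p ∈ T, ENNReal.ofReal (s / 2) * ENNReal.ofReal (p.2 - p.1) ≤
      ∫⁻ t in Icc p.1 p.2, {t | s < 2 * ‖f t‖}.indicator (fun t => ‖f t‖ₑ) t := by
    intro p hp
    have h1 : ∫⁻ t in Icc p.1 p.2, ‖f t‖ₑ ≤
        (∫⁻ t in Icc p.1 p.2, {t | s < 2 * ‖f t‖}.indicator (fun t => ‖f t‖ₑ) t) +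
          ENNReal.ofReal (s / 2) * ENNReal.ofReal (p.2 - p.1) := by
      rw [← Real.volume_Icc, ← setLIntegral_const, ← lintegral_add_right _ measurable_const]
      gcongr with t
      by_cases ht : s < 2 * ‖f t‖
      · simp [indicator, ht]
      · simp only [indicator, mem_ofPred_eq, ht, if_false, zero_add]
        rw [← ofReal_norm]
        exact ENNReal.ofReal_le_ofReal (by linarith)
    have h2 := hp.2.le.trans h1
    rw [show s = s / 2 + s / 2 by ring, ENNReal.ofReal_add (by positivity) (by positivity),
      add_mul, show s / 2 + s / 2 = s by ring] at h2
    exact (ENNReal.add_le_add_iff_right (by finiteness)).1 h2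
  have hsub : {x | ENNReal.ofReal s < maximalFn f x} ⊆
      ⋃ p ∈ u, Metric.closedBall ((p.1 + p.2) / 2) (5 * ((p.2 - p.1) / 2)) := by
    intro x hx
    obtain ⟨a, c, h, hxI, hJ⟩ := lt_maximalFn_iff.1 hx
    obtain ⟨p, hp, hsp⟩ := hcov (a, c) ⟨h, hJ⟩
    exact mem_biUnion hp (hsp hxI)
  calc _ ≤ ENNReal.ofReal s * ∑' p : u,
          volume (Metric.closedBall ((p.1.1 + p.1.2) / 2) (5 * ((p.1.2 - p.1.1) / 2))) := by
        gcongr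
        exact (measure_mono hsub).trans (measure_biUnion_le _ hcount _)
    _ = ∑' p : u, 10 * (ENNReal.ofReal (s / 2) * ENNReal.ofReal (p.1.2 - p.1.1)) := by
        rw [← ENNReal.tsum_mul_left]
        refine tsum_congr fun p => ?_
        rw [Real.volume_closedBall, ← ENNReal.ofReal_mul hs.le,
          ← ENNReal.ofReal_mul (by positivity), ← ENNReal.ofReal_ofNat,
          ← ENNReal.ofReal_mul (by norm_num)]
        congr 1
        simp only [OfNat.ofNat]
        ring
    _ ≤ ∑' p : u, 10 *
          ∫⁻ t in Icc p.1.1 p.1.2, {t | s < 2 * ‖f t‖}.indicator (fun t => ‖f t‖ₑ) t := by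
        gcongr with p
        exact hlen _ (huT p.2)
    _ = 10 * ∫⁻ t in ⋃ p ∈ u, Icc p.1 p.2,
          {t | s < 2 * ‖f t‖}.indicator (fun t => ‖f t‖ₑ) t := by
        rw [ENNReal.tsum_mul_left, lintegral_biUnion hcount (fun _ _ => measurableSet_Icc) hdisj]
    _ ≤ 10 * ∫⁻ t, {t | s < 2 * ‖f t‖}.indicator (fun t => ‖f t‖ₑ) t := by
        gcongr; exact Measure.restrict_le_self
    _ = _ := by rw [lintegral_indicator hE]

/-- The Hardy-Littlewood maximal theorem in `L²`. -/
theorem lintegral_maximalFn_sq_le {f : ℝ → ℂ} (hc : Continuous f) (hf : MemLp f 2 volume) :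
    ∫⁻ x, maximalFn f x ^ 2 ≤ 40 * ∫⁻ t, ‖f t‖ₑ ^ 2 := by
  have hfin := maximalFn_lt_top hc hf
  have hKm : Measurable (Function.uncurry fun (s t : ℝ) =>
      {p : ℝ × ℝ | p.1 < 2 * ‖f p.2‖}.indicator (fun p => ‖f p.2‖ₑ) (s, t)) :=
    Measurable.indicator (hc.measurable.comp measurable_snd).enorm
      (measurableSet_lt measurable_fst (by fun_prop))
  calc ∫⁻ x, maximalFn f x ^ 2 = ∫⁻ x, ENNReal.ofReal ((maximalFn f x).toReal ^ (2 : ℝ)) := by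
        refine lintegral_congr fun x => ?_
        rw [Real.rpow_ofNat, ENNReal.ofReal_pow toReal_nonneg, ENNReal.ofReal_toReal (hfin x).ne]
    -- Layer-cake formula. The factor s meets the weak type bound, and Tonelli leaves |f| times the
    -- length 2|f| of the range of s: 2·10·2 = 40.
    _ = ENNReal.ofReal 2 * ∫⁻ s in Ioi (0 : ℝ), volume {x | s < (maximalFn f x).toReal} *
          ENNReal.ofReal (s ^ ((2 : ℝ) - 1)) :=
        lintegral_rpow_eq_lintegral_meas_lt_mul _ (ae_of_all _ fun _ => toReal_nonneg)
          (measurable_maximalFn f).ennreal_toReal.aemeasurable (by norm_num)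
    _ ≤ 2 * ∫⁻ s in Ioi (0 : ℝ), 10 * ∫⁻ t,
          {p : ℝ × ℝ | p.1 < 2 * ‖f p.2‖}.indicator (fun p => ‖f p.2‖ₑ) (s, t) := by
        rw [ENNReal.ofReal_ofNat]
        gcongr 2 * ?_
        refine setLIntegral_mono' measurableSet_Ioi fun s hs => ?_
        have h := mul_volume_lt_maximalFn_le hc.measurable hf hs
        rw [← lintegral_indicator (measurableSet_lt measurable_const (by fun_prop))] at h
        rw [show (2 : ℝ) - 1 = 1 by norm_num, Real.rpow_one, mul_comm]
        simp only [← ENNReal.ofReal_lt_iff_lt_toReal (le_of_lt hs) (hfin _).ne]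
        exact h
    _ = 20 * ∫⁻ s in Ioi (0 : ℝ), ∫⁻ t,
          {p : ℝ × ℝ | p.1 < 2 * ‖f p.2‖}.indicator (fun p => ‖f p.2‖ₑ) (s, t) := by
        rw [lintegral_const_mul' _ _ (by norm_num), ← mul_assoc]; norm_num
    _ = 20 * ∫⁻ t, ∫⁻ s in Ioi (0 : ℝ),
          {p : ℝ × ℝ | p.1 < 2 * ‖f p.2‖}.indicator (fun p => ‖f p.2‖ₑ) (s, t) := by
        rw [lintegral_lintegral_swap hKm.aemeasurable]
    _ = 20 * ∫⁻ t, 2 * ‖f t‖ₑ ^ 2 := by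
        congr 1
        refine lintegral_congr fun t => ?_
        calc _ = ∫⁻ s in Ioi (0 : ℝ), (Iio (2 * ‖f t‖)).indicator (fun _ => ‖f t‖ₑ) s := rfl
          _ = ‖f t‖ₑ * ENNReal.ofReal (2 * ‖f t‖) := by
              rw [lintegral_indicator measurableSet_Iio, setLIntegral_const,
                Measure.restrict_apply measurableSet_Iio, Iio_inter_Ioi, Real.volume_Ioo, sub_zero]
          _ = _ := by
              rw [ENNReal.ofReal_mul (by norm_num), ofReal_norm, ENNReal.ofReal_ofNat]; ring
    _ = _ := by
        rw [lintegral_const_mul' _ _ (by norm_num), ← mul_assoc]; norm_num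

/-! ### From absolute kernel bounds to the seven inequalities. -/

lemma ae_integrable_of_lintegral_lt_top {k : ℝ → ℝ → ℂ}
    (hk : AEMeasurable (Function.uncurry k) (volume.prod volume))
    (h : ∀ᵐ x, ∫⁻ y, ‖k x y‖ₑ < ⊤) : ∀ᵐ x : ℝ, Integrable (fun y => k x y) volume := by
  filter_upwards [hk.aestronglyMeasurable.prodMk_left, h] with x h1 h2
  exact ⟨h1, h2⟩

lemma integralBound_top {k : ℝ → ℝ → ℂ} {D : ENNReal}
    (hk : AEMeasurable (Function.uncurry k) (volume.prod volume)) (hD : D < ⊤)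
    (h : ∀ x, ∫⁻ y, ‖k x y‖ₑ ≤ D) : IntegralBound k ⊤ D := by
  refine ⟨ae_integrable_of_lintegral_lt_top hk (ae_of_all _ fun x => (h x).trans_lt hD),
    hk.aestronglyMeasurable.integral_prod_right', ?_⟩
  rw [eLpNorm_exponent_top]
  exact eLpNormEssSup_le_of_ae_enorm_bound
    (ae_of_all _ fun x => (enorm_integral_le_lintegral_enorm _).trans (h x))

lemma integralBound_two {k : ℝ → ℝ → ℂ} {D : ENNReal}
    (hk : AEMeasurable (Function.uncurry k) (volume.prod volume))
    (hfin : ∀ᵐ x, ∫⁻ y, ‖k x y‖ₑ < ⊤)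
    (h : ∫⁻ x, (∫⁻ y, ‖k x y‖ₑ) ^ 2 ≤ D ^ 2) : IntegralBound k 2 D := by
  refine ⟨ae_integrable_of_lintegral_lt_top hk hfin,
    hk.aestronglyMeasurable.integral_prod_right', le_of_pow_two_le_pow_two ?_⟩
  change normL2 _ ^ 2 ≤ _
  rw [normL2_sq]
  refine le_trans ?_ h
  gcongr with x
  exact enorm_integral_le_lintegral_enorm _

lemma ae_lintegral_kernel_lt_top {b : ℝ → ℂ} (hb : MemBMO b) {f₁ f₂ : ℝ → ℂ}
    (h₁ : C1DerivL2 f₁) (h₂ : C1DerivL2 f₂) {G : ℝ → ENNReal}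
    (hG : AEMeasurable G volume)
    (hG2 : ∫⁻ y, G y ^ 2 < ⊤) :
    ∀ᵐ x, ∫⁻ y, (avgDev b x y + avgDev b y x) * (diffQuot f₁ x y * diffQuot f₂ x y) * G y < ⊤ := by
  have hD := aemeasurable_avgDev hb.1
  have hD' : AEMeasurable (fun p : ℝ × ℝ => avgDev b p.2 p.1) (volume.prod volume) :=
    hD.comp_quasiMeasurePreserving
      (Measure.measurePreserving_swap (μ := volume) (ν := volume)).quasiMeasurePreserving
  have hm : AEMeasurable (Function.uncurry fun x y =>
      (avgDev b x y + avgDev b y x) * (diffQuot f₁ x y * diffQuot f₂ x y) * G y)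
      (volume.prod volume) :=
    ((hD.add hD').mul ((measurable_diffQuot h₁.1.continuous).mul
      (measurable_diffQuot h₂.1.continuous)).aemeasurable).mul hG.comp_snd
  have hB := hb.2
  have hN₁ : normL2 (deriv f₁) < ⊤ := h₁.2.2
  have hN₂ : normL2 (deriv f₂) < ⊤ := h₂.2.2
  have h := (lintegral_sq_kernel_le hb h₁ h₂ hG).trans_lt (by finiteness)
  filter_upwards [ae_lt_top' (hm.lintegral_prod_right'.pow_const 2) h.ne] with x hx
  exact (ENNReal.pow_lt_top_iff.1 hx).resolve_right two_ne_zero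

/-- Almost everywhere finiteness is a separate hypothesis because D may be infinite, in which case
the norm bound says nothing about convergence. -/
lemma integralBound_of_enorm_le {b : ℝ → ℂ} (hb : MemBMO b) {f₁ f₂ : ℝ → ℂ}
    (h₁ : C1DerivL2 f₁) (h₂ : C1DerivL2 f₂) {k : ℝ → ℝ → ℂ}
    {G : ℝ → ENNReal} {D E : ENNReal}
    (hk : AEMeasurable (Function.uncurry k) (volume.prod volume)) (hG : AEMeasurable G volume)
    (hle : ∀ x y, ‖k x y‖ₑ ≤
      (avgDev b x y + avgDev b y x) * (diffQuot f₁ x y * diffQuot f₂ x y) * G y)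
    (hfin : ∀ᵐ x, ∫⁻ y, ‖k x y‖ₑ < ⊤) (hGD : ∫⁻ y, G y ^ 2 ≤ D ^ 2)
    (hE : 80000 * (bmoNorm b * (normL2 (deriv f₁) * normL2 (deriv f₂))) * D ≤ E) :
    IntegralBound k 2 E := by
  refine integralBound_two hk hfin ?_
  calc _ ≤ ∫⁻ x, (∫⁻ y,
        (avgDev b x y + avgDev b y x) * (diffQuot f₁ x y * diffQuot f₂ x y) * G y) ^ 2 := by
        gcongr with x y
        exact hle x y
    _ ≤ _ := lintegral_sq_kernel_le hb h₁ h₂ hG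
    _ ≤ (80000 * (bmoNorm b * (normL2 (deriv f₁) * normL2 (deriv f₂)))) ^ 2 * D ^ 2 := by gcongr
    _ ≤ E ^ 2 := by rw [← mul_pow]; gcongr

lemma enorm_add_sub_two_avg_le (b : ℝ → ℂ) (x y : ℝ) :
    ‖b x + b y - 2 * avg b x y‖ₑ ≤ avgDev b x y + avgDev b y x := by
  rw [avgDev, avgDev, avg_comm b y x]
  refine le_trans (le_of_eq ?_) (enorm_add_le _ _)
  congr 1; ring

lemma enorm_sub_le_avgDev (b : ℝ → ℂ) (x y : ℝ) :
    ‖b x - b y‖ₑ ≤ avgDev b x y + avgDev b y x := by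
  rw [avgDev, avgDev, avg_comm b y x, add_comm]
  refine le_trans (le_of_eq ?_) enorm_sub_le
  congr 1; ring

lemma lintegral_maximalFn_deriv_sq_le {f : ℝ → ℂ} (hf : C1DerivL2 f) :
    ∫⁻ x, maximalFn (deriv f) x ^ 2 ≤ (7 * normL2 (deriv f)) ^ 2 := by
  refine (lintegral_maximalFn_sq_le (hf.1.continuous_deriv (by norm_num)) hf.2).trans ?_
  rw [mul_pow, normL2_sq]
  gcongr
  norm_num

lemma enorm_kernel_two (c u₁ u₂ h : ℂ) :
    ‖c * (u₁ * u₂) / h ^ 2‖ₑ = ‖c‖ₑ * (‖u₁ / h‖ₑ * ‖u₂ / h‖ₑ) := by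
  rw [← enorm_mul, ← enorm_mul]; congr 1; ring

lemma enorm_kernel_three (c u₁ u₂ u₃ h : ℂ) :
    ‖c * (u₁ * u₂ * u₃) / h ^ 3‖ₑ = ‖c‖ₑ * (‖u₁ / h‖ₑ * ‖u₂ / h‖ₑ) * ‖u₃ / h‖ₑ := by
  rw [← enorm_mul, ← enorm_mul, ← enorm_mul]; congr 1; ring

lemma enorm_kernel_prod {n : ℕ} (hn : 3 ≤ n) (c h z : ℂ) (u : ℕ → ℂ) :
    ‖c * (∏ i ∈ Finset.Icc 1 n, u i) / h ^ n * z‖ₑ =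
      ‖c‖ₑ * (‖u 1 / h‖ₑ * ‖u 2 / h‖ₑ) * (‖z‖ₑ * ∏ i ∈ Finset.Icc 3 n, ‖u i / h‖ₑ) := by
  have e : Finset.Icc 1 n = insert 1 (insert 2 (Finset.Icc 3 n)) := by
    ext i; simp only [Finset.mem_Icc, Finset.mem_insert]; omega
  have e2 : (∏ i ∈ Finset.Icc 1 n, u i) / h ^ n = ∏ i ∈ Finset.Icc 1 n, (u i / h) := by
    rw [Finset.prod_div_distrib, Finset.prod_const, Nat.card_Icc, Nat.add_sub_cancel]
  have e3 : ‖∏ i ∈ Finset.Icc 3 n, u i / h‖ₑ = ∏ i ∈ Finset.Icc 3 n, ‖u i / h‖ₑ := by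
    simp only [enorm_eq_nnnorm, nnnorm_prod]
    push_cast
    rfl
  rw [mul_div_assoc, e2, e, Finset.prod_insert (by simp), Finset.prod_insert (by simp), ← e3,
    ← enorm_mul, ← enorm_mul, ← enorm_mul, ← enorm_mul]
  congr 1; ring

lemma aemeasurable_comp_fst_of_locallyIntegrable {b : ℝ → ℂ}
    (hb : LocallyIntegrable b volume) :
    AEMeasurable (fun p : ℝ × ℝ => b p.1) (volume.prod volume) :=
  hb.aestronglyMeasurable.aemeasurable.comp_fst

lemma aemeasurable_comp_snd_of_locallyIntegrable {b : ℝ → ℂ}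
    (hb : LocallyIntegrable b volume) :
    AEMeasurable (fun p : ℝ × ℝ => b p.2) (volume.prod volume) :=
  hb.aestronglyMeasurable.aemeasurable.comp_snd

lemma C1DerivL2.measurable_sub {f : ℝ → ℂ} (hf : C1DerivL2 f) :
    Measurable (fun p : ℝ × ℝ => f p.1 - f p.2) := by
  have := hf.1.continuous
  fun_prop

lemma measurable_sub_pow (n : ℕ) :
    Measurable (fun p : ℝ × ℝ => ((p.1 - p.2 : ℝ) : ℂ) ^ n) := by
  fun_prop

theorem propositionC12 :
    ∃ C : NNReal, ∀ b : ℝ → ℂ, MemBMO b →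
      (∀ f₁ f₂ : ℝ → ℂ, C1DerivL2 f₁ → C1DerivL2 f₂ →
        IntegralBound
          (fun x y => (b y - avg b x y) *
            ((f₁ x - f₁ y) * (f₂ x - f₂ y)) / ((x - y : ℝ) : ℂ) ^ 2)
          ⊤ (C * bmoNorm b * normL2 (deriv f₁) * normL2 (deriv f₂)) ∧
        IntegralBound
          (fun x y => (b y - avg b x y) ^ 2 *
            ((f₁ x - f₁ y) * (f₂ x - f₂ y)) / ((x - y : ℝ) : ℂ) ^ 2)
          ⊤ (C * bmoNorm b ^ 2 * normL2 (deriv f₁) * normL2 (deriv f₂))) ∧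
      (∀ f₁ f₂ g : ℝ → ℂ, C1DerivL2 f₁ → C1DerivL2 f₂ → MemLp g 2 volume →
        IntegralBound
          (fun x y => (b x + b y - 2 * avg b x y) *
            ((f₁ x - f₁ y) * (f₂ x - f₂ y)) / ((x - y : ℝ) : ℂ) ^ 2 * g y)
          2 (C * bmoNorm b * normL2 (deriv f₁) * normL2 (deriv f₂) * normL2 g) ∧
        IntegralBound
          (fun x y => (b x - b y) *
            ((f₁ x - f₁ y) * (f₂ x - f₂ y)) / ((x - y : ℝ) : ℂ) ^ 2 * g y)
          2 (C * bmoNorm b * normL2 (deriv f₁) * normL2 (deriv f₂) * normL2 g)) ∧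
      (∀ f₁ f₂ f₃ : ℝ → ℂ, C1DerivL2 f₁ → C1DerivL2 f₂ → C1DerivL2 f₃ →
        IntegralBound
          (fun x y => (b x + b y - 2 * avg b x y) *
            ((f₁ x - f₁ y) * (f₂ x - f₂ y) * (f₃ x - f₃ y)) / ((x - y : ℝ) : ℂ) ^ 3)
          2 (C * bmoNorm b * normL2 (deriv f₁) * normL2 (deriv f₂) * normL2 (deriv f₃)) ∧
        IntegralBound
          (fun x y => (b x - b y) *
            ((f₁ x - f₁ y) * (f₂ x - f₂ y) * (f₃ x - f₃ y)) / ((x - y : ℝ) : ℂ) ^ 3)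
          2 (C * bmoNorm b * normL2 (deriv f₁) * normL2 (deriv f₂) * normL2 (deriv f₃))) ∧
      (∀ (n : ℕ) (f : ℕ → ℝ → ℂ) (g : ℝ → ℂ), 3 ≤ n →
        (∀ i ∈ Finset.Icc 1 n, C1DerivL2 (f i)) → MemLp g 2 volume →
        IntegralBound
          (fun x y => (b x - b y) *
            (∏ i ∈ Finset.Icc 1 n, (f i x - f i y)) / ((x - y : ℝ) : ℂ) ^ n * g y)
          2 (C * bmoNorm b * normL2 (deriv (f 1)) * normL2 (deriv (f 2)) *
            eLpNorm (fun y => ‖g y‖ₑ * ∏ i ∈ Finset.Icc 3 n, maximalFn (deriv (f i)) y)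
              2 volume)) := by
  -- 560000 = 80000·7, where 7 comes from 40 ≤ 7² in the maximal theorem.
  refine ⟨560000, fun b hb => ?_⟩
  simp only [ENNReal.coe_ofNat]
  have hB := hb.2
  have mb₁ := aemeasurable_comp_fst_of_locallyIntegrable hb.1
  have mb₂ := aemeasurable_comp_snd_of_locallyIntegrable hb.1
  have ma : AEMeasurable (fun p : ℝ × ℝ => avg b p.1 p.2) (volume.prod volume) :=
    (measurable_avg hb.1).aemeasurable
  have mh := fun n => (measurable_sub_pow n).aemeasurable (μ := volume.prod volume)
  have mc := (mb₁.add mb₂).sub (ma.const_mul 2)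
  have mf : ∀ {f}, C1DerivL2 f →
      AEMeasurable (fun p : ℝ × ℝ => f p.1 - f p.2) (volume.prod volume) :=
    fun hf => hf.measurable_sub.aemeasurable
  refine ⟨fun f₁ f₂ h₁ h₂ => ?_, fun f₁ f₂ g h₁ h₂ hg => ?_, fun f₁ f₂ f₃ h₁ h₂ h₃ => ?_,
    fun n f g hn hf hg => ?_⟩
  · have hN₁ : normL2 (deriv f₁) < ⊤ := h₁.2.2
    have hN₂ : normL2 (deriv f₂) < ⊤ := h₂.2.2
    constructor
    · refine integralBound_top (((mb₂.sub ma).mul ((mf h₁).mul (mf h₂))).div (mh 2))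
        (by finiteness) fun x => ?_
      simp only [enorm_kernel_two]
      refine (lintegral_avgDev_mul_le hb h₁ h₂ x).trans ?_
      simp only [← mul_assoc]
      gcongr
      norm_num
    · refine integralBound_top ((((mb₂.sub ma).pow_const 2).mul ((mf h₁).mul (mf h₂))).div (mh 2))
        (by finiteness) fun x => ?_
      simp only [enorm_kernel_two, enorm_pow]
      refine (lintegral_avgDev_sq_mul_le hb h₁ h₂ x).trans ?_
      simp only [← mul_assoc]
      gcongr
      norm_num
  · have key : ∀ c : ℝ → ℝ → ℂ, AEMeasurable (Function.uncurry c) (volume.prod volume) →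
        (∀ x y, ‖c x y‖ₑ ≤ avgDev b x y + avgDev b y x) → IntegralBound
          (fun x y => c x y * ((f₁ x - f₁ y) * (f₂ x - f₂ y)) / ((x - y : ℝ) : ℂ) ^ 2 * g y)
          2 (560000 * bmoNorm b * normL2 (deriv f₁) * normL2 (deriv f₂) * normL2 g) := by
      intro c hc hle
      have hG2 := (normL2_sq g).symm
      have hle' : ∀ x y,
          ‖c x y * ((f₁ x - f₁ y) * (f₂ x - f₂ y)) / ((x - y : ℝ) : ℂ) ^ 2 * g y‖ₑ ≤
          (avgDev b x y + avgDev b y x) * (diffQuot f₁ x y * diffQuot f₂ x y) * ‖g y‖ₑ := by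
        intro x y
        rw [enorm_mul, enorm_kernel_two]
        gcongr
        · exact hle x y
        · exact le_rfl
        · exact le_rfl
      refine integralBound_of_enorm_le hb h₁ h₂
        (((hc.mul ((mf h₁).mul (mf h₂))).div (mh 2)).mul hg.1.aemeasurable.comp_snd)
        hg.1.enorm hle' ?_ hG2.le ?_
      · have hgt : normL2 g < ⊤ := hg.2
        filter_upwards [ae_lintegral_kernel_lt_top hb h₁ h₂ hg.1.enorm
          (by rw [hG2]; finiteness)] with x hx
        exact (lintegral_mono fun y => hle' x y).trans_lt hx
      · simp only [← mul_assoc]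
        gcongr
        norm_num
    exact ⟨key _ mc (enorm_add_sub_two_avg_le b), key _ (mb₁.sub mb₂) (enorm_sub_le_avgDev b)⟩
  · have key : ∀ c : ℝ → ℝ → ℂ, AEMeasurable (Function.uncurry c) (volume.prod volume) →
        (∀ x y, ‖c x y‖ₑ ≤ avgDev b x y + avgDev b y x) → IntegralBound
          (fun x y => c x y *
            ((f₁ x - f₁ y) * (f₂ x - f₂ y) * (f₃ x - f₃ y)) / ((x - y : ℝ) : ℂ) ^ 3)
          2 (560000 * bmoNorm b * normL2 (deriv f₁) * normL2 (deriv f₂) *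
            normL2 (deriv f₃)) := by
      intro c hc hle
      have hG2 := lintegral_maximalFn_deriv_sq_le h₃
      have hGm := (measurable_maximalFn (deriv f₃)).aemeasurable (μ := volume)
      have hle' : ∀ x y,
          ‖c x y * ((f₁ x - f₁ y) * (f₂ x - f₂ y) * (f₃ x - f₃ y)) / ((x - y : ℝ) : ℂ) ^ 3‖ₑ ≤
          (avgDev b x y + avgDev b y x) * (diffQuot f₁ x y * diffQuot f₂ x y) *
            maximalFn (deriv f₃) y := by
        intro x y
        rw [enorm_kernel_three]
        gcongr
        · exact hle x y
        · exact le_rfl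
        · exact le_rfl
        · exact diffQuot_le_maximalFn h₃ left_mem_uIcc
      refine integralBound_of_enorm_le hb h₁ h₂
        ((hc.mul (((mf h₁).mul (mf h₂)).mul (mf h₃))).div (mh 3)) hGm hle' ?_ hG2 ?_
      · have hN₃ : normL2 (deriv f₃) < ⊤ := h₃.2.2
        filter_upwards [ae_lintegral_kernel_lt_top hb h₁ h₂ hGm
          (hG2.trans_lt (by finiteness))] with x hx
        exact (lintegral_mono fun y => hle' x y).trans_lt hx
      · refine le_of_eq ?_; ring
    exact ⟨key _ mc (enorm_add_sub_two_avg_le b), key _ (mb₁.sub mb₂) (enorm_sub_le_avgDev b)⟩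
  · have h₁ := hf 1 (Finset.mem_Icc.2 ⟨by omega, by omega⟩)
    have h₂ := hf 2 (Finset.mem_Icc.2 ⟨by omega, by omega⟩)
    have h₃ : ∀ i ∈ Finset.Icc 3 n, C1DerivL2 (f i) := fun i hi => by
      rw [Finset.mem_Icc] at hi
      exact hf i (Finset.mem_Icc.2 ⟨by omega, by omega⟩)
    have hGm : AEMeasurable (fun y => ‖g y‖ₑ * ∏ i ∈ Finset.Icc 3 n, maximalFn (deriv (f i)) y)
        volume :=
      hg.1.enorm.mul (Finset.measurable_fun_prod _
        fun i _ => measurable_maximalFn (deriv (f i))).aemeasurable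
    have hk : AEMeasurable (Function.uncurry fun x y => (b x - b y) *
        (∏ i ∈ Finset.Icc 1 n, (f i x - f i y)) / ((x - y : ℝ) : ℂ) ^ n * g y)
        (volume.prod volume) :=
      (((mb₁.sub mb₂).mul (Finset.aemeasurable_fun_prod _ fun i hi => mf (hf i hi))).div
        (mh n)).mul hg.1.aemeasurable.comp_snd
    refine integralBound_of_enorm_le hb h₁ h₂ hk hGm (fun x y => ?_) ?_ (D := eLpNorm (fun y =>
      ‖g y‖ₑ * ∏ i ∈ Finset.Icc 3 n, maximalFn (deriv (f i)) y) 2 volume) (le_of_eq ?_) ?_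
    · rw [enorm_kernel_prod hn]
      gcongr with i hi
      · exact enorm_sub_le_avgDev b x y
      · exact le_rfl
      · exact le_rfl
      · exact diffQuot_le_maximalFn (h₃ i hi) left_mem_uIcc
    · have hgt : normL2 g < ⊤ := hg.2
      filter_upwards [ae_lintegral_kernel_lt_top hb h₁ h₂ hg.1.enorm
        (by rw [← normL2_sq]; finiteness)] with x hx
      -- The maximal functions are taken at x, not y: they become a finite constant in the
      -- y-integral, and convergence reduces to the bilinear kernel against g even when the
      -- right-hand norm is infinite.
      have hP : ∏ i ∈ Finset.Icc 3 n, maximalFn (deriv (f i)) x < ⊤ :=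
        ENNReal.prod_lt_top fun i hi =>
          maximalFn_lt_top ((h₃ i hi).1.continuous_deriv (by norm_num)) (h₃ i hi).2 x
      refine lt_of_le_of_lt ?_ (ENNReal.mul_lt_top hx hP)
      rw [← lintegral_mul_const' _ _ hP.ne]
      refine lintegral_mono fun y => ?_
      rw [enorm_kernel_prod hn, ← mul_assoc]
      gcongr with i hi
      · exact enorm_sub_le_avgDev b x y
      · exact le_rfl
      · exact le_rfl
      · exact diffQuot_le_maximalFn (h₃ i hi) right_mem_uIcc
    · rw [eLpNorm_eq_lintegral_rpow_enorm_toReal (by norm_num) (by norm_num),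
        ← ENNReal.rpow_natCast, ← ENNReal.rpow_mul]
      simp
    · simp only [← mul_assoc]
      gcongr
      norm_num
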